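/- Let $n\ge 1$, $T>0$, let $\sigma$ be the uniform probability measure on the unit sphere $S^{n-1}\subset\mathbb{R}^n$, let $m_0,m_f\in\mathbb{R}^n$, and let $\Sigma_0,\Sigma_f$ be symmetric positive definite $n\times n$ matrices. For symmetric positive definite $\Sigma$ and $t\in[0,T)$ put $$K(t,\Sigma)=\frac{1}{T-t}\Big[\int_{S^{n-1}}\sqrt{\frac{\theta^\top\Sigma_f\theta}{\theta^\top\Sigma\theta}}\;\theta\theta^\top\,d\sigma(\theta)-\frac1n I\Big].$$ A random trajectory $x(t)$, $t\in[0,T)$, in $\mathbb{R}^n$ whose law at each time has a finite second moment and a density is called a solution of the closed loop if almost surely $\dot x(t)=v(t,x(t))$ for all $t\in[0,T)$ (one-sided derivative at $t=0$), where $$v(t,x)=-\frac{1}{T-t}\int_{S^{n-1}}\big(\theta^\top x-\mathcal{T}_t^\theta(\theta^\top x)\big)\,\theta\,d\sigma(\theta)$$ and $\mathcal{T}_t^\theta:\mathbb{R}\to\mathbb{R}$ is the (nondecreasing) optimal transport map, for the quadratic cost, from the law of $\theta^\top x(t)$ to the image of $\mathcal N(m_f,\Sigma_f)$ under $y\mapsto\theta^\top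 y$; the integral over $\theta$ is required to converge absolutely along the trajectory. **Theorem.** Let $x$ be a solution of the closed loop with $x(0)\sim\mathcal N(m_0,\Sigma_0)$. Assume that 1. $x$ is unique: every solution $y$ of the closed loop on the same probability space with $y(0)=x(0)$ almost surely satisfies $y(t)=x(t)$ almost surely, for every $t\in[0,T)$; 2. the equation $\dot\Sigma(t)=K(t,\Sigma(t))\Sigma(t)+\Sigma(t)K(t,\Sigma(t))^\top$, $\Sigma(0)=\Sigma_0$, has a solution on $[0,T)$ that stays positive definite up to and including the terminal time, in the sense that there is $c>0$ with $\Sigma(t)\succeq cI$ for all $t\in[0,T)$ (this holds in particular if $\Sigma$ extends to a continuous positive definite function on $[0,T]$). Then $x(t)\sim\mathcal N(m(t),\Sigma(t))$ for every $t\in[0,T)$, where $m(t)=\mathbb E[x(t)]$, and the mean and the covariance of the state converge to those of the target: $$\lim_{t\nearrow T}m(t)=m_f,\qquad \lim_{t\nearrow T}\operatorname{Cov}(x(t))=\lim_{t\nearrow T}\Sigma(t)=\Sigma_f .$$ Moreover, independently of the dynamics, if $A$ is a symmetric positive definite and $G$ a symmetric positive semidefinite $n\times n$ matrix with $$\int_{S^{n-1}}\sqrt{\frac{\theta^\top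 G\,\theta}{\theta^\top A\,\theta}}\;\theta\theta^\top\,d\sigma(\theta)=\frac1n I,$$ then $A=G$. -/

import Mathlib

open MeasureTheory ProbabilityTheory Set Filter Topology Matrix
open scoped ENNReal RealInnerProductSpace

noncomputable section

namespace SlicedSteering

/-- The state space `ℝⁿ` with its Euclidean structure. -/
abbrev Vec (n : ℕ) : Type := EuclideanSpace ℝ (Fin n)

/-- The unit sphere of `ℝⁿ`. -/
abbrev Sphere (n : ℕ) : Type := Metric.sphere (0 : Vec n) 1

/-- The uniform probability measure `σ` on the unit sphere: the surface measure divided by its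
total mass. -/
def sphereMeasure (n : ℕ) : Measure (Sphere n) :=
  ((volume : Measure (Vec n)).toSphere univ)⁻¹ • (volume : Measure (Vec n)).toSphere

/-- `γ` is a coupling of `μ` and `ν`. -/
def IsCoupling {E : Type*} [MeasurableSpace E] (μ ν : Measure E) (γ : Measure (E × E)) : Prop :=
  γ.map Prod.fst = μ ∧ γ.map Prod.snd = ν

/-- The squared quadratic Wasserstein distance: the infimum over all couplings of the expected
squared distance. -/
def wassersteinSq {E : Type*} [NormedAddCommGroup E] [MeasurableSpace E]
    (μ ν : Measure E) : ℝ≥0∞ :=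
  ⨅ (γ : Measure (E × E)) (_ : IsCoupling μ ν γ), ∫⁻ p, ‖p.1 - p.2‖ₑ ^ 2 ∂γ

/-- `τ` is the optimal transport map on the real line from `μ` to `ν` for the quadratic cost.
Transport and optimality determine `τ` only up to a `μ`-null set; the last field selects the
nondecreasing version, on the set of points that have mass of `μ` on both sides. -/
structure IsOptimalTransportMap (μ ν : Measure ℝ) (τ : ℝ → ℝ) : Prop where
  measurable : Measurable τ
  map_eq : μ.map τ = ν
  optimal : ∫⁻ s, ‖s - τ s‖ₑ ^ 2 ∂μ = wassersteinSq μ ν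
  monotoneOn : MonotoneOn τ {s | 0 < μ (Iio s) ∧ 0 < μ (Ioi s)}

variable {n : ℕ}

/-- The image of `μ` under the projection `x ↦ θᵀx`. -/
def slice (θ : Sphere n) (μ : Measure (Vec n)) : Measure ℝ :=
  μ.map fun x => ⟪(θ : Vec n), x⟫

/-- The integrand `θ ↦ (θᵀx - τ^θ(θᵀx)) θ` of the sliced feedback. -/
def slicedIntegrand (τ : Sphere n → ℝ → ℝ) (x : Vec n) (θ : Sphere n) : Vec n :=
  (⟪(θ : Vec n), x⟫ - τ θ ⟪(θ : Vec n), x⟫) • (θ : Vec n)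

/-- The ideal sliced feedback `v(t,x) = -(T-t)⁻¹ ∫ (θᵀx - τ^θ(θᵀx)) θ dσ(θ)`. -/
def slicedFeedback (T t : ℝ) (τ : Sphere n → ℝ → ℝ) (x : Vec n) : Vec n :=
  -((T - t)⁻¹ • ∫ θ, slicedIntegrand τ x θ ∂(sphereMeasure n))

/-- The random trajectory `x` solves `ẋ(t) = v(t, x(t))` on `[0, T)`, where `v` is the ideal sliced
feedback whose slicewise maps are, at each time, the optimal transport maps from the slices of the
law of `x t` to the slices of the target `ρf`. At each time the state has finite second moment
and a density. -/
def IsClosedLoop {Ω : Type*} [MeasurableSpace Ω] (P : Measure Ω) (T : ℝ)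
    (ρf : Measure (Vec n)) (x : ℝ → Ω → Vec n) : Prop :=
  ∃ τ : ℝ → Sphere n → ℝ → ℝ,
    (∀ t ∈ Ico 0 T, MemLp (x t) 2 P ∧ P.map (x t) ≪ volume ∧
      ∀ θ, IsOptimalTransportMap (slice θ (P.map (x t))) (slice θ ρf) (τ t θ)) ∧
    ∀ᵐ ω ∂P, ∀ t ∈ Ico 0 T,
      Integrable (slicedIntegrand (τ t) (x t ω)) (sphereMeasure n) ∧
      HasDerivWithinAt (fun s => x s ω) (slicedFeedback T t (τ t) (x t ω)) (Ico 0 T) t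

/-- The quadratic form `θᵀ A θ`. -/
def quadForm (A : Matrix (Fin n) (Fin n) ℝ) (θ : Sphere n) : ℝ :=
  (θ : Vec n).ofLp ⬝ᵥ (A *ᵥ (θ : Vec n).ofLp)

/-- The matrix `∫ √(θᵀ G θ / θᵀ A θ) θ θᵀ dσ(θ)`. -/
def slicedGain (G A : Matrix (Fin n) (Fin n) ℝ) : Matrix (Fin n) (Fin n) ℝ :=
  Matrix.of fun i j => ∫ θ : Sphere n,
    Real.sqrt (quadForm G θ / quadForm A θ) * ((θ : Vec n) i * (θ : Vec n) j) ∂(sphereMeasure n)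

/-- The linear part `K(t, A) = (T-t)⁻¹ (∫ √(θᵀ Cf θ / θᵀ A θ) θ θᵀ dσ(θ) - I/n)` of the
feedback. -/
def feedbackGain (T : ℝ) (Cf : Matrix (Fin n) (Fin n) ℝ) (t : ℝ)
    (A : Matrix (Fin n) (Fin n) ℝ) : Matrix (Fin n) (Fin n) ℝ :=
  (T - t)⁻¹ • (slicedGain Cf A - (1 / (n : ℝ)) • (1 : Matrix (Fin n) (Fin n) ℝ))

/-- `S` solves `Ṡ = K(t,S) S + S K(t,S)ᵀ` on `[0, T)` with `S(0) = C₀`, and is positive definite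
up to and including the terminal time. As the gain is singular at `t = T`, the latter is expressed
through a positive lower bound for `S(t)`, uniform over `[0, T)`; this holds in particular whenever
`S` is continuous and positive definite on `[0, T]`. -/
structure IsCovarianceSolution (T : ℝ) (C₀ Cf : Matrix (Fin n) (Fin n) ℝ)
    (S : ℝ → Matrix (Fin n) (Fin n) ℝ) : Prop where
  initial : S 0 = C₀
  ode : ∀ t ∈ Ico 0 T, ∀ i j, HasDerivWithinAt (fun s => S s i j)
    ((feedbackGain T Cf t (S t) * S t + S t * (feedbackGain T Cf t (S t))ᵀ) i j) (Ico 0 T) t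
  posDef : ∃ c : ℝ, 0 < c ∧
    ∀ t ∈ Ico 0 T, (S t - c • (1 : Matrix (Fin n) (Fin n) ℝ)).PosSemidef

/-- The covariance matrix of a random vector. -/
def covMatrix {Ω : Type*} [MeasurableSpace Ω] (P : Measure Ω) (X : Ω → Vec n) :
    Matrix (Fin n) (Fin n) ℝ :=
  Matrix.of fun i j => covariance (fun ω => X ω i) (fun ω => X ω j) P

end SlicedSteering

end

open SlicedSteering

noncomputable section

namespace SlicedSteering

variable {n : ℕ}

/-! Uniqueness of the closed loop reduces the dynamics to exhibiting one Gaussian solution. Between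
Gaussians the slicewise maps are affine, so the feedback is affine. Hence `y t = m t + M t (x₀ -
m₀)` is a solution, where `M' = K(t, S) M`, `M 0 = 1` and `m' = -(m - mf) / (n (T - t))`. Its
covariance `M C₀ Mᵀ` equals `S`, because with the gain along `S` frozen the covariance equation is
linear. The mean is explicit, and its deviation from `mf` decays like `(T - t)^(1/n)`.

The covariance converges by a Lyapunov argument. The cost `h(A) = ∫ (√(θᵀAθ) - √(θᵀGθ))² dσ` is
convex in `A` with gradient `-D`, where `D = gainError G A` (`slicedCost_sub_le`,
`hasDerivAt_slicedCost`). Along the flow with `G = Cf`, the bound `S ≥ cI` gives `h' ≤ -2c|D|²/(T -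
t)`. Convexity gives `h ≤ ⟨D, Cf - S⟩`, and `S` is bounded because `h` decreases, so `h² ≤ Q|D|²`
near `T`. Thus `h' ≤ -k h²/(T - t)`, and divergence of `∫ dt/(T - t)` forces `h → 0`
(`tendsto_zero_of_deriv_le`). Since `h` vanishes only at `Cf`, compactness yields `S → Cf`.

Rigidity is the same convexity: a zero of the gradient is a minimiser, and the minimum value `0` is
attained only at `G`. -/

/-! ### The uniform measure on the sphere and its second moments. -/

lemma isProbabilityMeasure_sphereMeasure (hn : 0 < n) :
    IsProbabilityMeasure (sphereMeasure n) := by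
  have : Nonempty (Fin n) := ⟨⟨0, hn⟩⟩
  have h : (volume : Measure (Vec n)).toSphere ≠ 0 := Measure.toSphere_ne_zero _
  constructor
  rw [sphereMeasure, Measure.smul_apply, smul_eq_mul, ENNReal.inv_mul_cancel]
  · exact Measure.measure_univ_ne_zero.2 h
  · exact measure_ne_top _ _

instance isFiniteMeasure_sphereMeasure : IsFiniteMeasure (sphereMeasure n) := by
  rcases Nat.eq_zero_or_pos n with rfl | hn
  · have : (volume : Measure (Vec 0)).toSphere = 0 := by
      rw [Measure.toSphere_eq_zero_iff]; infer_instance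
    rw [sphereMeasure, this]; simp only [smul_zero]; infer_instance
  · have := isProbabilityMeasure_sphereMeasure hn
    infer_instance

instance isOpenPosMeasure_sphereMeasure : (sphereMeasure n).IsOpenPosMeasure := by
  refine ⟨fun U hU hne => ?_⟩
  rw [sphereMeasure, Measure.smul_apply, smul_eq_mul]
  exact mul_ne_zero (ENNReal.inv_ne_zero.2 (measure_ne_top _ _)) (hU.measure_ne_zero _ hne)

/-- The self-map of the sphere induced by a linear isometry. -/
def sphereMap (e : Vec n ≃ₗᵢ[ℝ] Vec n) (θ : Sphere n) : Sphere n :=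
  ⟨e θ, by simp⟩

lemma continuous_sphereMap (e : Vec n ≃ₗᵢ[ℝ] Vec n) : Continuous (sphereMap e) :=
  (e.continuous.comp continuous_subtype_val).subtype_mk _

open scoped Pointwise in
-- The surface measure of a set is a multiple of the volume of the cone over it; a linear isometry
-- maps cones to cones and preserves volume.
lemma map_sphereMap (e : Vec n ≃ₗᵢ[ℝ] Vec n) :
    (sphereMeasure n).map (sphereMap e) = sphereMeasure n := by
  have hm := (continuous_sphereMap e).measurable
  ext s hs
  rw [Measure.map_apply hm hs, sphereMeasure, Measure.smul_apply, Measure.smul_apply,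
    Measure.toSphere_apply' _ (hm hs), Measure.toSphere_apply' _ hs]
  congr 2
  have hpre : Ioo (0 : ℝ) 1 • (Subtype.val '' (sphereMap e ⁻¹' s))
      = e ⁻¹' (Ioo (0 : ℝ) 1 • (Subtype.val '' s)) := by
    ext x
    simp only [Set.mem_smul, mem_image, mem_preimage]
    constructor
    · rintro ⟨r, hr, _, ⟨θ, hθ, rfl⟩, rfl⟩
      exact ⟨r, hr, _, ⟨_, hθ, rfl⟩, by simp [sphereMap]⟩
    · rintro ⟨r, hr, _, ⟨θ, hθ, rfl⟩, h⟩
      refine ⟨r, hr, _, ⟨⟨e.symm θ, by simp⟩, ?_, rfl⟩, ?_⟩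
      · have : sphereMap e ⟨e.symm θ, by simp⟩ = θ := by ext1; simp [sphereMap]
        convert hθ
      · apply e.injective
        simpa using h
  rw [hpre]
  exact (e.measurePreserving.measure_preimage_equiv (f := e.toMeasurableEquiv) _)

lemma integral_comp_sphereMap (e : Vec n ≃ₗᵢ[ℝ] Vec n) {f : Sphere n → ℝ} (hf : Continuous f) :
    ∫ θ, f (sphereMap e θ) ∂(sphereMeasure n) = ∫ θ, f θ ∂(sphereMeasure n) := by
  conv_rhs => rw [← map_sphereMap e]
  rw [integral_map (continuous_sphereMap e).aemeasurable hf.aestronglyMeasurable]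

lemma integrable_of_continuous {E : Type*} [NormedAddCommGroup E]
    {f : Sphere n → E} (hf : Continuous f) : Integrable f (sphereMeasure n) :=
  hf.integrable_of_hasCompactSupport (HasCompactSupport.of_compactSpace f)

lemma sum_sq_sphere (θ : Sphere n) : ∑ i, (θ : Vec n) i ^ 2 = 1 := by
  rw [← EuclideanSpace.real_norm_sq_eq]; simp

/-- Coordinate swaps make the diagonal moments equal, and they sum to `1`; reflecting the `i`-th
coordinate changes the sign of an off-diagonal moment. -/
lemma integral_mul_sphere (hn : 0 < n) (i j : Fin n) :
    ∫ θ : Sphere n, (θ : Vec n) i * (θ : Vec n) j ∂(sphereMeasure n)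
      = ((1 / (n : ℝ)) • (1 : Matrix (Fin n) (Fin n) ℝ)) i j := by
  have := isProbabilityMeasure_sphereMeasure hn
  rcases eq_or_ne i j with rfl | hij
  · have hsame : ∀ k, ∫ θ : Sphere n, (θ : Vec n) k * (θ : Vec n) k ∂(sphereMeasure n)
        = ∫ θ : Sphere n, (θ : Vec n) i * (θ : Vec n) i ∂(sphereMeasure n) := by
      intro k
      rw [← integral_comp_sphereMap
        (LinearIsometryEquiv.piLpCongrLeft 2 ℝ ℝ (Equiv.swap i k))
        (f := fun θ => (θ : Vec n) i * (θ : Vec n) i) (by fun_prop)]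
      simp [sphereMap, LinearIsometryEquiv.piLpCongrLeft_apply]
    have hsum : ∑ k, ∫ θ : Sphere n, (θ : Vec n) k * (θ : Vec n) k ∂(sphereMeasure n) = 1 := by
      rw [← integral_finsetSum _ fun k _ => integrable_of_continuous (by fun_prop)]
      simp [← sq, sum_sq_sphere]
    simp only [hsame, Finset.sum_const, Finset.card_univ, Fintype.card_fin, nsmul_eq_mul] at hsum
    have hn' : (n : ℝ) ≠ 0 := by positivity
    simp only [Matrix.smul_apply, Matrix.one_apply_eq, smul_eq_mul, mul_one]
    rw [eq_div_iff hn']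
    linarith
  · have h := integral_comp_sphereMap (LinearIsometryEquiv.piLpCongrRight 2
        (fun k : Fin n => if k = i then LinearIsometryEquiv.neg ℝ (E := ℝ)
          else LinearIsometryEquiv.refl ℝ ℝ))
        (f := fun θ => (θ : Vec n) i * (θ : Vec n) j) (by fun_prop)
    simp [sphereMap, hij.symm, integral_neg] at h
    simp only [Matrix.smul_apply, Matrix.one_apply_ne hij, smul_zero]
    linarith

/-! ### Optimal transport on the line and Gaussian slices. -/

lemma lintegral_enorm_sq_eq {α : Type*} [MeasurableSpace α] {μ : Measure α} {f : α → ℝ}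
    (hf : MemLp f 2 μ) : ∫⁻ a, ‖f a‖ₑ ^ 2 ∂μ = ENNReal.ofReal (∫ a, f a ^ 2 ∂μ) := by
  rw [ofReal_integral_eq_lintegral_ofReal hf.integrable_sq (ae_of_all _ fun _ => sq_nonneg _)]
  refine lintegral_congr fun a => ?_
  rw [← ofReal_norm, ← ENNReal.ofReal_pow (norm_nonneg _), Real.norm_eq_abs, sq_abs]

/-- An increasing affine map is the optimal transport map between a measure with finite second
moment and its image. -/
lemma isOptimalTransportMap_affine (μ : Measure ℝ) [IsProbabilityMeasure μ]
    (hμ : MemLp id 2 μ) {q : ℝ} (hq : 0 < q) (a b : ℝ) :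
    IsOptimalTransportMap μ (μ.map fun s => b + q * (s - a)) (fun s => b + q * (s - a)) := by
  set τ : ℝ → ℝ := fun s => b + q * (s - a) with hτ
  have hτm : Measurable τ := by fun_prop
  have hμ' : MemLp (fun s : ℝ => s) 2 μ := hμ
  have hτL : MemLp τ 2 μ :=
    (memLp_const b).add ((hμ'.sub (memLp_const a)).const_mul q)
  refine ⟨hτm, rfl, le_antisymm ?_ ?_, fun s _ t _ hst => ?_⟩
  · refine le_iInf₂ fun γ hγ => ?_
    have hfst : MemLp (fun p : ℝ × ℝ => p.1) 2 γ := by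
      have h := hμ'
      rw [← hγ.1] at h
      exact (memLp_map_measure_iff h.1 measurable_fst.aemeasurable).1 h
    have hsnd : MemLp (fun p : ℝ × ℝ => p.2) 2 γ := by
      have h : MemLp (fun s : ℝ => s) 2 (μ.map τ) :=
        (memLp_map_measure_iff aestronglyMeasurable_id hτm.aemeasurable).2 hτL
      rw [← hγ.2] at h
      exact (memLp_map_measure_iff h.1 measurable_snd.aemeasurable).1 h
    have hprob : IsProbabilityMeasure γ := by
      have : IsProbabilityMeasure (γ.map Prod.fst) := by rw [hγ.1]; infer_instance
      exact Measure.isProbabilityMeasure_of_map Prod.fst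
    -- the Kantorovich potentials
    set φ : ℝ → ℝ := fun s => s ^ 2 - 2 * b * s - q * (s - a) ^ 2 with hφ
    set ψ : ℝ → ℝ := fun s => s ^ 2 - 2 * a * (s - b) - q⁻¹ * (s - b) ^ 2 with hψ
    have hφi : ∀ {α : Type} [MeasurableSpace α] {ν : Measure α} [IsProbabilityMeasure ν]
        {f : α → ℝ}, MemLp f 2 ν → Integrable (fun x => φ (f x)) ν := by
      intro α _ ν _ f hf
      exact (hf.integrable_sq.sub ((hf.integrable one_le_two).const_mul _)).sub
        ((hf.sub (memLp_const a)).integrable_sq.const_mul q)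
    have hψi : ∀ {α : Type} [MeasurableSpace α] {ν : Measure α} [IsProbabilityMeasure ν]
        {f : α → ℝ}, MemLp f 2 ν → Integrable (fun x => ψ (f x)) ν := by
      intro α _ ν _ f hf
      exact (hf.integrable_sq.sub (((hf.sub (memLp_const b)).integrable one_le_two).const_mul _)).sub
        ((hf.sub (memLp_const b)).integrable_sq.const_mul q⁻¹)
    -- The duality gap is a perfect square that vanishes exactly on the graph of `τ`. Integrating
    -- the inequality against any coupling and the equality along `τ` proves optimality.
    have hle : ∀ s t : ℝ, φ s + ψ t ≤ (s - t) ^ 2 := by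
      intro s t
      have h : (s - t) ^ 2 - (φ s + ψ t) = q⁻¹ * (q * (s - a) - (t - b)) ^ 2 := by
        simp only [hφ, hψ]; field_simp; ring
      have : 0 ≤ q⁻¹ * (q * (s - a) - (t - b)) ^ 2 := by positivity
      linarith
    have heq : ∀ s : ℝ, φ s + ψ (τ s) = (s - τ s) ^ 2 := by
      intro s
      simp only [hφ, hψ, hτ]; field_simp; ring
    rw [lintegral_enorm_sq_eq (f := fun s => s - τ s) (hμ'.sub hτL),
      lintegral_enorm_sq_eq (f := fun p : ℝ × ℝ => p.1 - p.2) (hfst.sub hsnd)]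
    refine ENNReal.ofReal_le_ofReal ?_
    calc ∫ s, (s - τ s) ^ 2 ∂μ = ∫ s, φ s ∂μ + ∫ s, ψ (τ s) ∂μ := by
          rw [← integral_add (hφi hμ') (hψi hτL)]
          exact integral_congr_ae (ae_of_all _ fun s => (heq s).symm)
      _ = ∫ p, φ p.1 ∂γ + ∫ p, ψ p.2 ∂γ := by
          rw [← integral_map (φ := τ) (f := ψ) hτm.aemeasurable (by fun_prop), ← hγ.2,
            integral_map measurable_snd.aemeasurable (by fun_prop)]
          congr 1
          rw [← integral_map (φ := Prod.fst) (μ := γ) (f := φ) measurable_fst.aemeasurable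
            (by fun_prop), hγ.1]
      _ = ∫ p, (φ p.1 + ψ p.2) ∂γ := (integral_add (hφi hfst) (hψi hsnd)).symm
      _ ≤ ∫ p, (p.1 - p.2) ^ 2 ∂γ :=
          integral_mono ((hφi hfst).add (hψi hsnd)) (hfst.sub hsnd).integrable_sq
            fun p => hle p.1 p.2
  · refine iInf₂_le_of_le (μ.map fun s => (s, τ s)) ⟨?_, ?_⟩ (le_of_eq ?_)
    · rw [Measure.map_map measurable_fst (by fun_prop)]
      exact Measure.map_id
    · rw [Measure.map_map measurable_snd (by fun_prop)]
      rfl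
    · rw [lintegral_map (by fun_prop) (by fun_prop)]
  · simp only [hτ]
    gcongr

lemma inner_toEuclideanCLM_mul (θ x : Vec n) (A : Matrix (Fin n) (Fin n) ℝ) :
    ⟪θ, toEuclideanCLM (𝕜 := ℝ) A x⟫ = ⟪toEuclideanCLM (𝕜 := ℝ) Aᵀ θ, x⟫ := by
  rw [← ContinuousLinearMap.adjoint_inner_left]
  congr 1
  rw [← ContinuousLinearMap.star_eq_adjoint, ← map_star]
  rfl

/-- The image of a Gaussian under an affine map is Gaussian. -/
lemma multivariateGaussian_map_affine (m m' : Vec n) {C : Matrix (Fin n) (Fin n) ℝ}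
    (hC : C.PosSemidef) (A : Matrix (Fin n) (Fin n) ℝ) :
    (multivariateGaussian m C).map (fun x => m' + toEuclideanCLM (𝕜 := ℝ) A (x - m))
      = multivariateGaussian m' (A * C * Aᵀ) := by
  have hACA : (A * C * Aᵀ).PosSemidef := hC.mul_mul_conjTranspose_same A
  have : IsProbabilityMeasure
      ((multivariateGaussian m C).map (fun x => m' + toEuclideanCLM (𝕜 := ℝ) A (x - m))) :=
    Measure.isProbabilityMeasure_map (by fun_prop)
  apply Measure.ext_of_charFun (E := Vec n)
  ext θ
  rw [charFun_multivariateGaussian hACA, charFun_apply, integral_map (by fun_prop) (by fun_prop)]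
  have h : ∀ x : Vec n, ⟪m' + toEuclideanCLM (𝕜 := ℝ) A (x - m), θ⟫
      = ⟪x, toEuclideanCLM (𝕜 := ℝ) Aᵀ θ⟫
        + (⟪θ, m'⟫ - ⟪toEuclideanCLM (𝕜 := ℝ) Aᵀ θ, m⟫) := by
    intro x
    rw [real_inner_comm, inner_add_right, inner_toEuclideanCLM_mul, inner_sub_right,
      real_inner_comm x]
    ring
  simp_rw [h, Complex.ofReal_add, add_mul, Complex.exp_add]
  rw [integral_mul_const, ← charFun_apply, charFun_multivariateGaussian hC, ← Complex.exp_add]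
  congr 1
  have h2 : ∀ v : Vec n, v.ofLp ⬝ᵥ (A * C * Aᵀ) *ᵥ v.ofLp
      = (toEuclideanCLM (𝕜 := ℝ) Aᵀ v).ofLp ⬝ᵥ C *ᵥ (toEuclideanCLM (𝕜 := ℝ) Aᵀ v).ofLp := by
    intro v
    rw [Matrix.ofLp_toEuclideanCLM, ← Matrix.mulVec_mulVec, ← Matrix.mulVec_mulVec,
      Matrix.dotProduct_mulVec v.ofLp A, ← Matrix.mulVec_transpose]
  rw [h2]
  push_cast
  ring

lemma inner_eq_dotProduct (x y : Vec n) : ⟪x, y⟫ = x.ofLp ⬝ᵥ y.ofLp := by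
  simp [PiLp.inner_apply, dotProduct, mul_comm]

lemma slice_multivariateGaussian (m : Vec n) {C : Matrix (Fin n) (Fin n) ℝ}
    (hC : C.PosSemidef) (θ : Sphere n) :
    slice θ (multivariateGaussian m C)
      = gaussianReal ⟪(θ : Vec n), m⟫ (quadForm C θ).toNNReal := by
  have h := IsGaussian.map_eq_gaussianReal (μ := multivariateGaussian m C)
    (innerSL ℝ (θ : Vec n))
  have h1 : ∫ x, innerSL ℝ (θ : Vec n) x ∂(multivariateGaussian m C) = ⟪(θ : Vec n), m⟫ := by
    rw [ContinuousLinearMap.integral_comp_id_comm IsGaussian.integrable_id]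
    simp
  have h2 : Var[innerSL ℝ (θ : Vec n); multivariateGaussian m C] = quadForm C θ := by
    rw [quadForm, ← covarianceBilin_multivariateGaussian (μ := m) hC,
      covarianceBilin_self IsGaussian.memLp_two_id]
    rfl
  rw [h1, h2] at h
  exact h

/-- The optimal transport map between two slices of Gaussians. -/
lemma isOptimalTransportMap_slice {m m' : Vec n} {C C' : Matrix (Fin n) (Fin n) ℝ}
    (hC : C.PosSemidef) (hC' : C'.PosSemidef) (θ : Sphere n) (h : 0 < quadForm C θ)
    (h' : 0 < quadForm C' θ) :
    IsOptimalTransportMap (slice θ (multivariateGaussian m C))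
      (slice θ (multivariateGaussian m' C'))
      (fun s => ⟪(θ : Vec n), m'⟫ + √(quadForm C' θ / quadForm C θ) * (s - ⟪(θ : Vec n), m⟫)) := by
  rw [slice_multivariateGaussian m hC, slice_multivariateGaussian m' hC']
  have hopt := isOptimalTransportMap_affine
    (gaussianReal ⟪(θ : Vec n), m⟫ (quadForm C θ).toNNReal) (memLp_id_gaussianReal 2)
    (q := √(quadForm C' θ / quadForm C θ)) (by positivity) ⟪(θ : Vec n), m⟫ ⟪(θ : Vec n), m'⟫
  convert hopt using 1
  rw [show (fun s : ℝ => ⟪(θ : Vec n), m'⟫ +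
      √(quadForm C' θ / quadForm C θ) * (s - ⟪(θ : Vec n), m⟫))
      = (fun s => ⟪(θ : Vec n), m'⟫ + s) ∘ (fun s => √(quadForm C' θ / quadForm C θ) * s)
        ∘ (fun s => s - ⟪(θ : Vec n), m⟫) from rfl,
    ← Measure.map_map (by fun_prop) (by fun_prop), ← Measure.map_map (by fun_prop) (by fun_prop),
    gaussianReal_map_sub_const, gaussianReal_map_const_mul, gaussianReal_map_const_add]
  congr 1
  · simp
  · ext
    simp [Real.sq_sqrt (div_pos h' h).le, Real.coe_toNNReal _ h.le, Real.coe_toNNReal _ h'.le]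
    field_simp

/-! ### Linear differential equations in a normed algebra. -/

section LinearODE

variable {𝔸 : Type*} [NormedRing 𝔸] [NormedAlgebra ℝ 𝔸]

/-- The terms of the Peano-Baker series of the linear equation `Φ' = K Φ`, `Φ 0 = 1`. -/
def peanoBaker (K : ℝ → 𝔸) : ℕ → ℝ → 𝔸
  | 0, _ => 1
  | k + 1, t => ∫ s in (0 : ℝ)..t, K s * peanoBaker K k s

variable {K : ℝ → 𝔸} {T : ℝ}

lemma exists_norm_le_of_continuousOn_Ico {E : Type*} [NormedAddCommGroup E] {f : ℝ → E}
    (hf : ContinuousOn f (Ico 0 T)) {b : ℝ} (hb : b < T) :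
    ∃ M, 0 ≤ M ∧ ∀ t ∈ Icc 0 b, ‖f t‖ ≤ M := by
  obtain ⟨M, hM⟩ := isCompact_Icc.exists_bound_of_continuousOn
    (hf.mono (Icc_subset_Ico_right hb))
  exact ⟨max M 0, le_max_right _ _, fun t ht => (hM t ht).trans (le_max_left _ _)⟩

/-- Uniqueness for the linear equation `X' = K X + X L`. -/
theorem eqOn_of_linear_ode {L X Y : ℝ → 𝔸} (hK : ContinuousOn K (Ico 0 T))
    (hL : ContinuousOn L (Ico 0 T))
    (hX : ∀ t ∈ Ico 0 T, HasDerivWithinAt X (K t * X t + X t * L t) (Ico 0 T) t)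
    (hY : ∀ t ∈ Ico 0 T, HasDerivWithinAt Y (K t * Y t + Y t * L t) (Ico 0 T) t)
    (h0 : X 0 = Y 0) : EqOn X Y (Ico 0 T) := by
  intro b hb
  -- The coefficients may blow up at `T`, so the Grönwall estimate is run on `[0, b]` with `b < T`.
  obtain ⟨M, hM0, hM⟩ := exists_norm_le_of_continuousOn_Ico hK hb.2
  obtain ⟨N, hN0, hN⟩ := exists_norm_le_of_continuousOn_Ico hL hb.2
  have hZ : ∀ t ∈ Ico 0 T, HasDerivWithinAt (X - Y)
      (K t * (X - Y) t + (X - Y) t * L t) (Ico 0 T) t := by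
    intro t ht
    refine ((hX t ht).sub (hY t ht)).congr_deriv ?_
    simp only [Pi.sub_apply]
    noncomm_ring
  have hsub : Icc 0 b ⊆ Ico 0 T := Icc_subset_Ico_right hb.2
  have h := eq_zero_of_abs_deriv_le_mul_abs_self_of_eq_zero_right (K := M + N) (a := 0) (b := b)
    (f := X - Y) (f' := fun t => K t * (X - Y) t + (X - Y) t * L t)
    (fun t ht => ((hZ t (hsub ht)).continuousWithinAt).mono hsub)
    (fun t ht => (hZ t (hsub (Ico_subset_Icc_self ht))).mono_of_mem_nhdsWithin
      (mem_of_superset (Ico_mem_nhdsGE (ht.2.trans hb.2)) (Ico_subset_Ico_left ht.1)))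
    (by simp [h0])
    (fun t ht => by
      have ht' := Ico_subset_Icc_self ht
      calc _ ≤ ‖K t‖ * ‖(X - Y) t‖ + ‖(X - Y) t‖ * ‖L t‖ :=
            (norm_add_le _ _).trans (add_le_add (norm_mul_le _ _) (norm_mul_le _ _))
        _ ≤ M * ‖(X - Y) t‖ + ‖(X - Y) t‖ * N := by
            gcongr
            · exact hM t ht'
            · exact hN t ht'
        _ = _ := by ring) b ⟨hb.1, le_rfl⟩
  exact sub_eq_zero.1 h

/-- Each integration turns `|x|^k / k!` into the next term of the exponential series. The factor
`‖1‖` stays because the norm of the unit is not assumed to be `1`. -/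
lemma norm_peanoBaker_le {M : ℝ} {s : Set ℝ} (hs : s.OrdConnected) (h0 : (0 : ℝ) ∈ s)
    (hM0 : 0 ≤ M) (hM : ∀ t ∈ s, ‖K t‖ ≤ M) (k : ℕ) :
    ∀ t ∈ s, ‖peanoBaker K k t‖ ≤ ‖(1 : 𝔸)‖ * ((M * |t|) ^ k / k.factorial) := by
  induction k with
  | zero => intro t _; simp [peanoBaker]
  | succ k ih =>
    intro t ht
    have hsub : uIoc 0 t ⊆ s := uIoc_subset_uIcc.trans (hs.uIcc_subset h0 ht)
    have hint : IntegrableOn (fun x : ℝ => |x - 0| ^ k) (uIoc 0 t) := by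
      rw [← intervalIntegrable_iff]
      exact (by fun_prop : Continuous fun x : ℝ => |x - 0| ^ k).intervalIntegrable _ _
    calc ‖peanoBaker K (k + 1) t‖ ≤ ∫ x in uIoc 0 t, ‖K x * peanoBaker K k x‖ :=
          intervalIntegral.norm_integral_le_integral_norm_uIoc
      _ ≤ ∫ x in uIoc 0 t, (‖(1 : 𝔸)‖ * M ^ (k + 1) / k.factorial) * |x - 0| ^ k := by
          refine integral_mono_of_nonneg (ae_of_all _ fun _ => norm_nonneg _)
            (hint.const_mul _) ?_
          filter_upwards [ae_restrict_mem measurableSet_uIoc] with x hx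
          calc ‖K x * peanoBaker K k x‖ ≤ ‖K x‖ * ‖peanoBaker K k x‖ := norm_mul_le _ _
            _ ≤ M * (‖(1 : 𝔸)‖ * ((M * |x|) ^ k / k.factorial)) := by
                gcongr
                · exact hM x (hsub hx)
                · exact ih x (hsub hx)
            _ = _ := by rw [sub_zero]; ring
      _ = ‖(1 : 𝔸)‖ * ((M * |t|) ^ (k + 1) / (k + 1).factorial) := by
          rw [integral_const_mul, integral_pow_abs_sub_uIoc, sub_zero, Nat.factorial_succ]
          push_cast
          field_simp
          ring

variable [CompleteSpace 𝔸]

/-- Both claims go in one induction: differentiating a term needs continuity of the previous one,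
which comes from its own derivative. -/
lemma hasDerivAt_peanoBaker_succ (hT : 0 < T) (hK : ContinuousOn K (Iio T)) (k : ℕ) :
    ContinuousOn (peanoBaker K k) (Iio T) ∧
      ∀ t < T, HasDerivAt (peanoBaker K (k + 1)) (K t * peanoBaker K k t) t := by
  have step : ∀ k, ContinuousOn (peanoBaker K k) (Iio T) →
      ∀ t < T, HasDerivAt (peanoBaker K (k + 1)) (K t * peanoBaker K k t) t := by
    intro k hk t ht
    have hc : ContinuousOn (fun s => K s * peanoBaker K k s) (Iio T) := hK.mul hk
    have hsub : uIcc 0 t ⊆ Iio T := fun s hs => lt_of_le_of_lt hs.2 (max_lt hT ht)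
    exact intervalIntegral.integral_hasDerivAt_right (hc.mono hsub).intervalIntegrable
      (hc.stronglyMeasurableAtFilter isOpen_Iio t ht) (hc.continuousAt (Iio_mem_nhds ht))
  induction k with
  | zero => exact ⟨continuousOn_const, step 0 continuousOn_const⟩
  | succ k ih =>
    have h : ContinuousOn (peanoBaker K (k + 1)) (Iio T) :=
      fun t ht => (ih.2 t ht).continuousAt.continuousWithinAt
    exact ⟨h, step _ h⟩

/-- Linear equations with continuous coefficients on `[0, T)` have fundamental solutions. -/
theorem exists_fundamental_solution (hT : 0 < T) (hK : ContinuousOn K (Ico 0 T)) :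
    ∃ Φ : ℝ → 𝔸, Φ 0 = 1 ∧
      ∀ t ∈ Ico 0 T, HasDerivWithinAt Φ (K t * Φ t) (Ico 0 T) t := by
  -- Freezing `K` at negative times allows two-sided derivatives on an open interval around every `t
  -- ≥ 0`, including `t = 0`.
  set K' : ℝ → 𝔸 := fun t => K (max t 0) with hK'
  have hK'c : ContinuousOn K' (Iio T) :=
    hK.comp (by fun_prop) fun t ht => ⟨le_max_right _ _, max_lt ht hT⟩
  refine ⟨fun t => ∑' k, peanoBaker K' k t, ?_, fun t ht => ?_⟩
  · beta_reduce
    rw [tsum_eq_single 0]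
    · rfl
    · rintro (_ | k) hk
      · exact absurd rfl hk
      · simp [peanoBaker]
  obtain ⟨b, htb, hbT⟩ := exists_between ht.2
  have hb0 : 0 < b := ht.1.trans_lt htb
  obtain ⟨M, hM0, hM⟩ := exists_norm_le_of_continuousOn_Ico hK hbT
  have hM' : ∀ s ∈ Ioo (-b) b, ‖K' s‖ ≤ M := fun s hs =>
    hM _ ⟨le_max_right _ _, max_le hs.2.le hb0.le⟩
  have hmem0 : (0 : ℝ) ∈ Ioo (-b) b := ⟨by linarith, hb0⟩
  have hmemt : t ∈ Ioo (-b) b := ⟨by linarith [ht.1], htb⟩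
  have hφ : ∀ k, ∀ s ∈ Ioo (-b) b,
      ‖peanoBaker K' k s‖ ≤ ‖(1 : 𝔸)‖ * ((M * b) ^ k / k.factorial) := by
    intro k s hs
    refine (norm_peanoBaker_le ordConnected_Ioo hmem0 hM0 hM' k s hs).trans ?_
    have : |s| ≤ b := (abs_lt.2 hs).le
    gcongr
  have hsum : Summable fun k : ℕ => ‖(1 : 𝔸)‖ * ((M * b) ^ k / k.factorial) :=
    (Real.summable_pow_div_factorial _).mul_left _
  have hsumφ : ∀ s ∈ Ioo (-b) b, Summable fun k => peanoBaker K' k s := fun s hs =>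
    Summable.of_norm_bounded hsum fun k => hφ k s hs
  -- Termwise derivatives: the constant term gives `0`, and term `j + 1` gives `K'` times term `j`,
  -- so the shifted sum is `K'` times the series.
  set g : ℕ → ℝ → 𝔸 := fun k s => Nat.casesOn k 0 fun j => K' s * peanoBaker K' j s with hg
  set u : ℕ → ℝ := fun k => Nat.casesOn k 0
    fun j => M * (‖(1 : 𝔸)‖ * ((M * b) ^ j / j.factorial)) with hu
  have hder : HasDerivAt (fun s => ∑' k, peanoBaker K' k s) (∑' k, g k t) t := by
    refine hasDerivAt_tsum_of_isPreconnected (u := u) (t := Ioo (-b) b) (y₀ := t)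
      ((summable_nat_add_iff 1).1 (hsum.mul_left M)) isOpen_Ioo isPreconnected_Ioo ?_ ?_ hmemt
      (hsumφ t hmemt) hmemt
    · rintro (_ | k) s hs
      · exact hasDerivAt_const s (1 : 𝔸)
      · exact (hasDerivAt_peanoBaker_succ hT hK'c k).2 s (hs.2.trans hbT)
    · rintro (_ | k) s hs
      · simp [hg, hu]
      · exact (norm_mul_le _ _).trans
          (mul_le_mul (hM' s hs) (hφ k s hs) (norm_nonneg _) hM0)
  have hgsum : ∑' k, g k t = K t * ∑' k, peanoBaker K' k t := by
    have hs : Summable fun k => g k t :=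
      (summable_nat_add_iff 1).1 ((hsumφ t hmemt).mul_left (K' t))
    rw [hs.tsum_eq_zero_add]
    have hK't : K' t = K t := by simp only [hK', max_eq_left ht.1]
    rw [← hK't, ← (hsumφ t hmemt).tsum_mul_left]
    exact zero_add _
  rw [hgsum] at hder
  exact hder.hasDerivWithinAt

end LinearODE

/-! ### Quadratic forms on the sphere and convexity of the sliced cost. -/

lemma quadForm_eq_sum (A : Matrix (Fin n) (Fin n) ℝ) (θ : Sphere n) :
    quadForm A θ = ∑ p : Fin n × Fin n, A p.1 p.2 * ((θ : Vec n) p.1 * (θ : Vec n) p.2) := by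
  simp only [quadForm, dotProduct, mulVec, Fintype.sum_prod_type, Finset.mul_sum]
  refine Finset.sum_congr rfl fun i _ => Finset.sum_congr rfl fun j _ => by ring

lemma continuous_quadForm_uncurry :
    Continuous fun p : (Fin n → Fin n → ℝ) × Sphere n => quadForm (Matrix.of p.1) p.2 := by
  simp only [quadForm_eq_sum, Matrix.of_apply]
  fun_prop

@[fun_prop]
lemma continuous_quadForm (A : Matrix (Fin n) (Fin n) ℝ) : Continuous (quadForm A) := by
  unfold quadForm
  fun_prop

lemma quadForm_sub (A B : Matrix (Fin n) (Fin n) ℝ) (θ : Sphere n) :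
    quadForm (A - B) θ = quadForm A θ - quadForm B θ := by
  simp [quadForm, Matrix.sub_mulVec, dotProduct_sub]

lemma quadForm_nonneg {A : Matrix (Fin n) (Fin n) ℝ} (hA : A.PosSemidef) (θ : Sphere n) :
    0 ≤ quadForm A θ :=
  hA.dotProduct_mulVec_nonneg _

lemma quadForm_pos {A : Matrix (Fin n) (Fin n) ℝ} (hA : A.PosDef) (θ : Sphere n) :
    0 < quadForm A θ := by
  refine hA.dotProduct_mulVec_pos fun h => ?_
  have := sum_sq_sphere θ
  simp [h] at this

lemma le_quadForm {A : Matrix (Fin n) (Fin n) ℝ} {c : ℝ}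
    (hA : (A - c • (1 : Matrix (Fin n) (Fin n) ℝ)).PosSemidef) (θ : Sphere n) :
    c ≤ quadForm A θ := by
  have h := quadForm_nonneg hA θ
  rw [quadForm_sub] at h
  have h1 : quadForm (c • (1 : Matrix (Fin n) (Fin n) ℝ)) θ = c := by
    rw [quadForm, Matrix.smul_mulVec, Matrix.one_mulVec, dotProduct_smul, ← inner_eq_dotProduct,
      real_inner_self_eq_norm_sq]
    simp
  linarith

/-- A symmetric matrix is determined by its quadratic form on the sphere. -/
lemma eq_of_quadForm_eq {A B : Matrix (Fin n) (Fin n) ℝ} (hA : A.IsHermitian)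
    (hB : B.IsHermitian) (h : ∀ θ : Sphere n, quadForm A θ = quadForm B θ) : A = B := by
  have hx : ∀ x : Fin n → ℝ, x ⬝ᵥ A *ᵥ x = x ⬝ᵥ B *ᵥ x := by
    intro x
    rcases eq_or_ne x 0 with rfl | hx
    · simp
    have hx' : WithLp.toLp 2 x ≠ (0 : Vec n) := fun h0 => hx (by simpa using h0)
    have hr : ‖WithLp.toLp 2 x‖ ≠ 0 := norm_ne_zero_iff.2 hx'
    have := h ⟨‖WithLp.toLp 2 x‖⁻¹ • WithLp.toLp 2 x, by simp [norm_smul, hr]⟩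
    simpa [quadForm, Matrix.mulVec_smul, hr] using this
  -- Antisymmetry of the Loewner order replaces polarization: both differences have zero quadratic
  -- form.
  open scoped MatrixOrder in
  refine le_antisymm (α := Matrix (Fin n) (Fin n) ℝ) ?_ ?_
  · refine Matrix.PosSemidef.of_dotProduct_mulVec_nonneg (hB.sub hA) fun x => ?_
    simp [Matrix.sub_mulVec, dotProduct_sub, hx]
  · refine Matrix.PosSemidef.of_dotProduct_mulVec_nonneg (hA.sub hB) fun x => ?_
    simp [Matrix.sub_mulVec, dotProduct_sub, hx]

/-- The deviation of the sliced gain from its stationary value. -/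
def gainError (G A : Matrix (Fin n) (Fin n) ℝ) : Matrix (Fin n) (Fin n) ℝ :=
  slicedGain G A - (1 / (n : ℝ)) • (1 : Matrix (Fin n) (Fin n) ℝ)

/-- The squared sliced distance between the centered Gaussians with covariances `A` and `G`. -/
def slicedCost (G A : Matrix (Fin n) (Fin n) ℝ) : ℝ :=
  ∫ θ : Sphere n, (√(quadForm A θ) - √(quadForm G θ)) ^ 2 ∂(sphereMeasure n)

lemma slicedCost_nonneg (G A : Matrix (Fin n) (Fin n) ℝ) : 0 ≤ slicedCost G A :=
  integral_nonneg fun _ => sq_nonneg _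

lemma slicedCost_self (G : Matrix (Fin n) (Fin n) ℝ) : slicedCost G G = 0 := by
  simp [slicedCost]

/-- The continuous integrand vanishes almost everywhere, hence everywhere, since `sphereMeasure`
charges every nonempty open set; the quadratic forms then agree. -/
lemma eq_of_slicedCost_eq_zero {G A : Matrix (Fin n) (Fin n) ℝ} (hA : A.PosSemidef)
    (hG : G.PosSemidef) (h : slicedCost G A = 0) : A = G := by
  have hc : Continuous fun θ : Sphere n => (√(quadForm A θ) - √(quadForm G θ)) ^ 2 := by fun_prop
  rw [slicedCost, integral_eq_zero_iff_of_nonneg (fun _ => sq_nonneg _)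
    (integrable_of_continuous hc), hc.ae_eq_iff_eq _ continuous_zero] at h
  refine eq_of_quadForm_eq hA.1 hG.1 fun θ => ?_
  have h1 := congrFun h θ
  simp only [Pi.zero_apply, ne_eq, OfNat.ofNat_ne_zero, not_false_eq_true, pow_eq_zero_iff,
    sub_eq_zero] at h1
  rwa [Real.sqrt_inj (quadForm_nonneg hA θ) (quadForm_nonneg hG θ)] at h1

lemma continuous_sqrt_div {G A : Matrix (Fin n) (Fin n) ℝ} (hA : ∀ θ, 0 < quadForm A θ) :
    Continuous fun θ : Sphere n => √(quadForm G θ / quadForm A θ) :=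
  ((continuous_quadForm G).div (continuous_quadForm A) fun θ => (hA θ).ne').sqrt

/-- Since `I/n = ∫ θθᵀ dσ`, the gain error is a single integral against `θθᵀ`, and pairing `θθᵀ`
with `M` gives `θᵀMθ`. -/
lemma sum_gainError_mul (hn : 0 < n) {G A : Matrix (Fin n) (Fin n) ℝ}
    (hA : ∀ θ, 0 < quadForm A θ) (M : Matrix (Fin n) (Fin n) ℝ) :
    ∑ p : Fin n × Fin n, gainError G A p.1 p.2 * M p.1 p.2
      = ∫ θ, (√(quadForm G θ / quadForm A θ) - 1) * quadForm M θ ∂(sphereMeasure n) := by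
  have hc := continuous_sqrt_div (G := G) hA
  have h : ∀ p : Fin n × Fin n, gainError G A p.1 p.2 = ∫ θ : Sphere n,
      (√(quadForm G θ / quadForm A θ) - 1) * ((θ : Vec n) p.1 * (θ : Vec n) p.2)
        ∂(sphereMeasure n) := by
    intro p
    rw [gainError, Matrix.sub_apply, ← integral_mul_sphere hn, slicedGain, Matrix.of_apply,
      ← integral_sub (integrable_of_continuous (by fun_prop))
        (integrable_of_continuous (by fun_prop))]
    refine integral_congr_ae (ae_of_all _ fun θ => ?_)
    ring
  simp_rw [h, ← integral_mul_const]
  rw [← integral_finsetSum _ fun p _ => integrable_of_continuous (by fun_prop)]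
  refine integral_congr_ae (ae_of_all _ fun θ => ?_)
  simp only [quadForm_eq_sum M, Finset.mul_sum]
  exact Finset.sum_congr rfl fun p _ => by ring

/-- The sliced cost is convex, with gradient `-gainError`. -/
lemma slicedCost_sub_le (hn : 0 < n) {G A B : Matrix (Fin n) (Fin n) ℝ}
    (hA : ∀ θ, 0 < quadForm A θ) (hB : ∀ θ, 0 ≤ quadForm B θ) :
    slicedCost G A - slicedCost G B
      ≤ ∑ p : Fin n × Fin n, gainError G A p.1 p.2 * (B - A) p.1 p.2 := by
  have hc := continuous_sqrt_div (G := G) hA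
  rw [sum_gainError_mul hn hA, slicedCost, slicedCost,
    ← integral_sub (integrable_of_continuous (by fun_prop))
      (integrable_of_continuous (by fun_prop))]
  refine integral_mono (integrable_of_continuous (by fun_prop))
    (integrable_of_continuous (by fun_prop)) fun θ => ?_
  have ha : 0 < √(quadForm A θ) := Real.sqrt_pos.2 (hA θ)
  -- With `a, b, g` the three square roots, the convexity defect of `s ↦ (√s - g)²` between `a²` and
  -- `b²` is `(g/a)(b - a)²`.
  have h : (√(quadForm G θ / quadForm A θ) - 1) * quadForm (B - A) θ
      - ((√(quadForm A θ) - √(quadForm G θ)) ^ 2 - (√(quadForm B θ) - √(quadForm G θ)) ^ 2)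
      = √(quadForm G θ) / √(quadForm A θ) * (√(quadForm B θ) - √(quadForm A θ)) ^ 2 := by
    rw [quadForm_sub, Real.sqrt_div' _ (hA θ).le]
    nth_rw 2 [← Real.sq_sqrt (hA θ).le]
    nth_rw 1 [← Real.sq_sqrt (hB θ)]
    field_simp
    ring
  have h2 : 0 ≤ √(quadForm G θ) / √(quadForm A θ)
      * (√(quadForm B θ) - √(quadForm A θ)) ^ 2 := by positivity
  simp only
  linarith

/-- The stationarity condition is rigid. -/
theorem eq_of_gainError_eq_zero (hn : 0 < n) {G A : Matrix (Fin n) (Fin n) ℝ} (hA : A.PosDef)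
    (hG : G.PosSemidef) (h : gainError G A = 0) : A = G := by
  -- Comparing with `B = G`, where the cost is `0`: a critical point of a convex function is a
  -- minimiser.
  have h1 := slicedCost_sub_le (G := G) hn (quadForm_pos hA) (quadForm_nonneg hG)
  simp only [h, slicedCost_self, Matrix.zero_apply, zero_mul, Finset.sum_const_zero,
    sub_zero] at h1
  exact eq_of_slicedCost_eq_zero hA.posSemidef hG (le_antisymm h1 (slicedCost_nonneg _ _))

lemma continuous_slicedCost (G : Matrix (Fin n) (Fin n) ℝ) :
    Continuous fun A : Fin n → Fin n → ℝ => slicedCost G (Matrix.of A) := by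
  have hq := continuous_quadForm_uncurry (n := n)
  have h := continuous_parametric_integral_of_continuous (μ := sphereMeasure n)
    (f := fun (A : Fin n → Fin n → ℝ) θ => (√(quadForm (Matrix.of A) θ) - √(quadForm G θ)) ^ 2)
    (by
      have h2 : Continuous fun p : (Fin n → Fin n → ℝ) × Sphere n => quadForm G p.2 := by fun_prop
      exact (hq.sqrt.sub h2.sqrt).pow 2) isCompact_univ
  simp only [Measure.restrict_univ] at h
  exact h

/-- Truncating the denominator below at `c` makes the integrand jointly continuous for all matrices,
and changes nothing on the given set. -/
lemma continuousOn_slicedGain {G : Matrix (Fin n) (Fin n) ℝ} {c : ℝ} (hc : 0 < c) (i j : Fin n) :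
    ContinuousOn (fun A : Fin n → Fin n → ℝ => slicedGain G (Matrix.of A) i j)
      {A | ∀ θ, c ≤ quadForm (Matrix.of A) θ} := by
  have hq := continuous_quadForm_uncurry (n := n)
  have h := continuous_parametric_integral_of_continuous (μ := sphereMeasure n)
    (f := fun (A : Fin n → Fin n → ℝ) (θ : Sphere n) =>
      √(quadForm G θ / max c (quadForm (Matrix.of A) θ)) * ((θ : Vec n) i * (θ : Vec n) j))
    (by
      have h2 : Continuous fun p : (Fin n → Fin n → ℝ) × Sphere n => quadForm G p.2 := by fun_prop
      have h3 : Continuous fun p : (Fin n → Fin n → ℝ) × Sphere n =>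
        (p.2 : Vec n) i * (p.2 : Vec n) j := by fun_prop
      exact (h2.div (continuous_const.max hq)
        fun p => (lt_max_of_lt_left hc).ne').sqrt.mul h3) isCompact_univ
  simp only [Measure.restrict_univ] at h
  refine h.continuousOn.congr fun A hA => ?_
  simp only [slicedGain, Matrix.of_apply]
  refine integral_congr_ae (ae_of_all _ fun θ => ?_)
  simp only [max_eq_right (hA θ)]

/-! ### Estimates for the Lyapunov argument. -/

/-- A nonnegative function with `h' ≤ -k h² / (T - t)` tends to zero as `t ↗ T`. -/
lemma tendsto_zero_of_deriv_le {h h' : ℝ → ℝ} {a T k : ℝ} (haT : a < T) (hk : 0 < k)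
    (hder : ∀ t ∈ Ioo a T, HasDerivAt h (h' t) t) (hnn : ∀ t, 0 ≤ h t)
    (hle : ∀ t ∈ Ioo a T, h' t ≤ -(k * h t ^ 2 / (T - t))) :
    Tendsto h (𝓝[<] T) (𝓝 0) := by
  have hanti : AntitoneOn h (Ioo a T) := by
    refine antitoneOn_of_deriv_nonpos (convex_Ioo a T)
      (fun t ht => (hder t ht).continuousAt.continuousWithinAt) ?_ ?_ <;> rw [interior_Ioo]
    · exact fun t ht => (hder t ht).differentiableAt.differentiableWithinAt
    · intro t ht
      rw [(hder t ht).deriv]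
      refine (hle t ht).trans (neg_nonpos.2 ?_)
      have := sub_pos.2 ht.2
      positivity
  -- If `h ≥ ε` throughout, then `h - kε² log(T - t)` is nonincreasing, which drives `h` to `-∞`.
  -- One small value suffices, since `h` is nonincreasing.
  have hsmall : ∀ ε > 0, ∃ t ∈ Ioo a T, h t < ε := by
    intro ε hε
    by_contra! hcon
    set g : ℝ → ℝ := fun t => h t - k * ε ^ 2 * Real.log (T - t) with hg
    have hgd : ∀ t ∈ Ioo a T, HasDerivAt g (h' t - k * ε ^ 2 * (-1 / (T - t))) t := by
      intro t ht
      exact (hder t ht).sub ((((hasDerivAt_id t).const_sub T).log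
        (sub_pos.2 ht.2).ne').const_mul _)
    have hganti : AntitoneOn g (Ioo a T) := by
      refine antitoneOn_of_deriv_nonpos (convex_Ioo a T)
        (fun t ht => (hgd t ht).continuousAt.continuousWithinAt) ?_ ?_ <;> rw [interior_Ioo]
      · exact fun t ht => (hgd t ht).differentiableAt.differentiableWithinAt
      · intro t ht
        rw [(hgd t ht).deriv]
        have hTt := sub_pos.2 ht.2
        have h1 : k * ε ^ 2 / (T - t) ≤ k * h t ^ 2 / (T - t) := by
          have := hcon t ht
          gcongr
        have h2 : k * ε ^ 2 * (-1 / (T - t)) = -(k * ε ^ 2 / (T - t)) := by ring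
        have := hle t ht
        linarith
    obtain ⟨t₀, ht₀⟩ := exists_between haT
    have hlim : Tendsto (fun t => g t₀ + k * ε ^ 2 * Real.log (T - t)) (𝓝[<] T) atBot := by
      refine tendsto_atBot_add_const_left _ _ (Tendsto.const_mul_atBot (by positivity) ?_)
      refine Real.tendsto_log_nhdsGT_zero.comp (tendsto_nhdsWithin_iff.2 ⟨?_, ?_⟩)
      · exact ((by fun_prop : Continuous fun t => T - t).tendsto' T 0 (sub_self T)).mono_left
          nhdsWithin_le_nhds
      · filter_upwards [self_mem_nhdsWithin] with t ht using sub_pos.2 (mem_Iio.1 ht)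
    obtain ⟨t, ht1, ht2⟩ := ((hlim.eventually (eventually_lt_atBot 0)).and
      (Ioo_mem_nhdsLT ht₀.2)).exists
    have h1 := hganti ht₀ ⟨ht₀.1.trans ht2.1, ht2.2⟩ ht2.1.le
    have h2 := hnn t
    simp only [hg] at h1 ht1
    linarith
  rw [Metric.tendsto_nhds]
  intro ε hε
  obtain ⟨t₁, ht₁, hlt⟩ := hsmall ε hε
  filter_upwards [Ioo_mem_nhdsLT ht₁.2] with t ht
  rw [Real.dist_0_eq_abs, abs_of_nonneg (hnn t)]
  exact (hanti ht₁ ⟨ht₁.1.trans ht.1, ht.2⟩ ht.1.le).trans_lt hlt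

lemma sum_mul_eq_trace (A B : Matrix (Fin n) (Fin n) ℝ) :
    ∑ p : Fin n × Fin n, A p.1 p.2 * B p.1 p.2 = (Aᵀ * B).trace := by
  simp only [Matrix.trace, Matrix.diag_apply, Matrix.mul_apply, Matrix.transpose_apply,
    Fintype.sum_prod_type]
  rw [Finset.sum_comm]

lemma transpose_gainError (G A : Matrix (Fin n) (Fin n) ℝ) :
    (gainError G A)ᵀ = gainError G A := by
  ext i j
  simp only [Matrix.transpose_apply, gainError, Matrix.sub_apply, slicedGain, Matrix.of_apply,
    Matrix.smul_apply, Matrix.one_apply, eq_comm (a := j), mul_comm (((_ : Sphere n) : Vec n) j)]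

/-- The right side is `2 tr(DSD)`, and `D(S - cI)D` is positive semidefinite, so its trace is
nonnegative. -/
lemma sum_mul_lyapunov_ge {D S : Matrix (Fin n) (Fin n) ℝ} {c : ℝ} (hD : Dᵀ = D)
    (hS : (S - c • (1 : Matrix (Fin n) (Fin n) ℝ)).PosSemidef) :
    2 * c * ∑ p : Fin n × Fin n, D p.1 p.2 ^ 2
      ≤ ∑ p : Fin n × Fin n, D p.1 p.2 * (D * S + S * Dᵀ) p.1 p.2 := by
  have h := (hS.mul_mul_conjTranspose_same D).trace_nonneg
  simp only [Matrix.conjTranspose_eq_transpose_of_trivial, hD, Matrix.mul_sub, Matrix.sub_mul,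
    Matrix.trace_sub, Matrix.mul_smul, Matrix.smul_mul, Matrix.mul_one, Matrix.trace_smul,
    smul_eq_mul] at h
  have h1 : ∑ p : Fin n × Fin n, D p.1 p.2 ^ 2 = (D * D).trace := by
    simp_rw [sq, sum_mul_eq_trace, hD]
  have h2 : (D * (D * S)).trace = (D * S * D).trace := Matrix.trace_mul_comm _ _
  rw [h1, sum_mul_eq_trace, hD, Matrix.mul_add, Matrix.trace_add, h2, ← Matrix.mul_assoc]
  linarith

/-- Testing `S` on `eᵢ ± eⱼ` gives `2|Sᵢⱼ| ≤ Sᵢᵢ + Sⱼⱼ`. -/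
lemma abs_apply_le_trace {S : Matrix (Fin n) (Fin n) ℝ} (hS : S.PosSemidef) (i j : Fin n) :
    |S i j| ≤ S.trace := by
  have hd : ∀ k, 0 ≤ S k k := fun k => hS.diag_nonneg
  have hle : ∀ k, S k k ≤ S.trace := fun k =>
    Finset.single_le_sum (f := fun k => S k k) (fun k _ => hd k) (Finset.mem_univ k)
  have hsymm : S j i = S i j := hS.1.apply i j
  have key : ∀ s : ℝ, 0 ≤ S i i + 2 * s * S i j + s ^ 2 * S j j := by
    intro s
    have h := hS.dotProduct_mulVec_nonneg (Pi.single i 1 + s • Pi.single j 1)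
    simp only [star_trivial, Matrix.mulVec_add, Matrix.mulVec_smul, dotProduct_add, add_dotProduct,
      smul_dotProduct, dotProduct_smul, Matrix.mulVec_single_one, single_one_dotProduct,
      Matrix.col_apply, smul_eq_mul, hsymm] at h
    linarith
  have h1 := key 1
  have h2 := key (-1)
  have := hle i
  have := hle j
  rw [abs_le]
  constructor <;> linarith

/-- The trace is `n` times the spherical mean of the quadratic form, and `a² ≤ 2(a - g)² + 2g²`.
Sublevel sets of the cost are therefore bounded. -/
lemma trace_le_slicedCost (hn : 0 < n) {G A : Matrix (Fin n) (Fin n) ℝ} (hA : A.PosSemidef)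
    (hG : G.PosSemidef) : A.trace ≤ n * (2 * slicedCost G A) + 2 * G.trace := by
  have htr : ∀ M : Matrix (Fin n) (Fin n) ℝ,
      ∫ θ, quadForm M θ ∂(sphereMeasure n) = M.trace / n := by
    intro M
    simp_rw [quadForm_eq_sum]
    rw [integral_finsetSum _ fun p _ => integrable_of_continuous (by fun_prop)]
    simp_rw [integral_const_mul, integral_mul_sphere hn]
    simp [Fintype.sum_prod_type, Matrix.one_apply, Matrix.trace, div_eq_mul_inv, Finset.sum_mul]
  have h : A.trace / n ≤ 2 * slicedCost G A + 2 * (G.trace / n) := by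
    rw [← htr, ← htr, slicedCost, ← integral_const_mul, ← integral_const_mul,
      ← integral_add (integrable_of_continuous (by fun_prop))
        (integrable_of_continuous (by fun_prop))]
    refine integral_mono (integrable_of_continuous (by fun_prop))
      (integrable_of_continuous (by fun_prop)) fun θ => ?_
    have h1 := Real.sq_sqrt (quadForm_nonneg hA θ)
    have h2 := Real.sq_sqrt (quadForm_nonneg hG θ)
    have h3 := sq_nonneg (√(quadForm A θ) - 2 * √(quadForm G θ))
    simp only
    nlinarith
  have hn' : (0 : ℝ) < n := by exact_mod_cast hn
  rw [div_le_iff₀ hn'] at h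
  calc A.trace ≤ _ := h
    _ = _ := by field_simp

/-- The chain rule for the sliced cost along a differentiable curve of matrices. -/
lemma hasDerivAt_slicedCost (hn : 0 < n) {G : Matrix (Fin n) (Fin n) ℝ}
    {S : ℝ → Matrix (Fin n) (Fin n) ℝ} {S' : Matrix (Fin n) (Fin n) ℝ} {t₀ : ℝ}
    (hS : ∀ i j, HasDerivAt (fun t => S t i j) (S' i j) t₀)
    (hpos : ∀ᶠ t in 𝓝 t₀, ∀ θ, 0 < quadForm (S t) θ)
    (hD : ∀ i j, ContinuousAt (fun t => gainError G (S t) i j) t₀) :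
    HasDerivAt (fun t => slicedCost G (S t))
      (-∑ p : Fin n × Fin n, gainError G (S t₀) p.1 p.2 * S' p.1 p.2) t₀ := by
  rw [hasDerivAt_iff_tendsto_slope]
  -- Convexity based at `S t₀` and at `S t` squeezes the difference quotient between `lo` and `hi`,
  -- avoiding differentiation under the integral. Their order depends on the sign of `t - t₀`, hence
  -- the `min` and `max`.
  set lo : ℝ → ℝ := fun t => -∑ p : Fin n × Fin n,
    gainError G (S t₀) p.1 p.2 * slope (fun t => S t p.1 p.2) t₀ t with hlo
  set hi : ℝ → ℝ := fun t => -∑ p : Fin n × Fin n,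
    gainError G (S t) p.1 p.2 * slope (fun t => S t p.1 p.2) t₀ t with hhi
  have hslope : ∀ i j, Tendsto (slope (fun t => S t i j) t₀) (𝓝[≠] t₀) (𝓝 (S' i j)) :=
    fun i j => hasDerivAt_iff_tendsto_slope.1 (hS i j)
  have hlol : Tendsto lo (𝓝[≠] t₀)
      (𝓝 (-∑ p : Fin n × Fin n, gainError G (S t₀) p.1 p.2 * S' p.1 p.2)) :=
    (tendsto_finsetSum _ fun p _ => (hslope _ _).const_mul _).neg
  have hhil : Tendsto hi (𝓝[≠] t₀)
      (𝓝 (-∑ p : Fin n × Fin n, gainError G (S t₀) p.1 p.2 * S' p.1 p.2)) :=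
    (tendsto_finsetSum _ fun p _ =>
      ((hD p.1 p.2).tendsto.mono_left nhdsWithin_le_nhds).mul (hslope _ _)).neg
  have hmin := hlol.min hhil
  have hmax := hlol.max hhil
  rw [min_self] at hmin
  rw [max_self] at hmax
  have hpos₀ := hpos.self_of_nhds
  have hbd : ∀ᶠ t in 𝓝[≠] t₀, min (lo t) (hi t) ≤ slope (fun t => slicedCost G (S t)) t₀ t ∧
      slope (fun t => slicedCost G (S t)) t₀ t ≤ max (lo t) (hi t) := by
    filter_upwards [nhdsWithin_le_nhds hpos, self_mem_nhdsWithin] with t ht hne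
    have hne' : t - t₀ ≠ 0 := sub_ne_zero.2 hne
    have h1 := slicedCost_sub_le (G := G) hn hpos₀ fun θ => (ht θ).le
    have h2 := slicedCost_sub_le (G := G) hn ht fun θ => (hpos₀ θ).le
    have e1 : lo t * (t - t₀)
        = -∑ p : Fin n × Fin n, gainError G (S t₀) p.1 p.2 * (S t - S t₀) p.1 p.2 := by
      simp only [hlo, slope_def_field, neg_mul, Finset.sum_mul, Matrix.sub_apply]
      congr 1
      exact Finset.sum_congr rfl fun p _ => by field_simp
    have e2 : hi t * (t - t₀)
        = ∑ p : Fin n × Fin n, gainError G (S t) p.1 p.2 * (S t₀ - S t) p.1 p.2 := by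
      simp only [hhi, slope_def_field, neg_mul, Finset.sum_mul, Matrix.sub_apply,
        ← Finset.sum_neg_distrib]
      exact Finset.sum_congr rfl fun p _ => by field_simp; ring
    have e3 : slope (fun t => slicedCost G (S t)) t₀ t * (t - t₀)
        = slicedCost G (S t) - slicedCost G (S t₀) := by
      rw [slope_def_field]; field_simp
    set σ := slope (fun t => slicedCost G (S t)) t₀ t
    have b1 : lo t * (t - t₀) ≤ σ * (t - t₀) := by linarith
    have b2 : σ * (t - t₀) ≤ hi t * (t - t₀) := by linarith
    rcases lt_or_gt_of_ne hne' with hlt | hgt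
    · exact ⟨(min_le_right _ _).trans ((mul_le_mul_right_of_neg hlt).1 b2),
        ((mul_le_mul_right_of_neg hlt).1 b1).trans (le_max_left _ _)⟩
    · exact ⟨(min_le_left _ _).trans (le_of_mul_le_mul_right b1 hgt),
        (le_of_mul_le_mul_right b2 hgt).trans (le_max_right _ _)⟩
  exact tendsto_of_tendsto_of_tendsto_of_le_of_le' hmin hmax (hbd.mono fun _ h => h.1)
    (hbd.mono fun _ h => h.2)

/-! ### Convergence of the covariance equation. -/

section CovarianceSolution

variable {T : ℝ} {C₀ Cf : Matrix (Fin n) (Fin n) ℝ} {S : ℝ → Matrix (Fin n) (Fin n) ℝ}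

lemma feedbackGain_eq_smul_gainError (t : ℝ) (A : Matrix (Fin n) (Fin n) ℝ) :
    feedbackGain T Cf t A = (T - t)⁻¹ • gainError Cf A := rfl

lemma posDef_of_sub_smul_one {A : Matrix (Fin n) (Fin n) ℝ} {c : ℝ} (hc : 0 < c)
    (hA : (A - c • (1 : Matrix (Fin n) (Fin n) ℝ)).PosSemidef) : A.PosDef := by
  have h1 : (c • (1 : Matrix (Fin n) (Fin n) ℝ)).PosDef := Matrix.PosDef.one.smul hc
  simpa using h1.add_posSemidef hA

lemma IsCovarianceSolution.continuousOn_gainError (hS : IsCovarianceSolution T C₀ Cf S)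
    (i j : Fin n) : ContinuousOn (fun t => gainError Cf (S t) i j) (Ico 0 T) := by
  obtain ⟨c, hc, hcS⟩ := hS.posDef
  have hSc : ContinuousOn (fun t => (S t : Fin n → Fin n → ℝ)) (Ico 0 T) :=
    continuousOn_pi.2 fun i => continuousOn_pi.2 fun j t ht => (hS.ode t ht i j).continuousWithinAt
  have h := (continuousOn_slicedGain (G := Cf) hc i j).comp hSc
    (fun t ht θ => le_quadForm (hcS t ht) θ)
  exact h.sub continuousOn_const

/-- Solutions of the covariance equation converge to the target covariance. -/
theorem IsCovarianceSolution.tendsto (hn : 0 < n) (hT : 0 < T) (hCf : Cf.PosSemidef)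
    (hS : IsCovarianceSolution T C₀ Cf S) : Tendsto S (𝓝[<] T) (𝓝 Cf) := by
  obtain ⟨c, hc, hcS⟩ := hS.posDef
  have hpd : ∀ t ∈ Ico 0 T, (S t).PosDef := fun t ht => posDef_of_sub_smul_one hc (hcS t ht)
  set h : ℝ → ℝ := fun t => slicedCost Cf (S t) with hh
  set N : ℝ → ℝ := fun t => ∑ p : Fin n × Fin n, gainError Cf (S t) p.1 p.2 ^ 2 with hN
  set h' : ℝ → ℝ := fun t => -∑ p : Fin n × Fin n, gainError Cf (S t) p.1 p.2 *
    (feedbackGain T Cf t (S t) * S t + S t * (feedbackGain T Cf t (S t))ᵀ) p.1 p.2 with hh'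
  have hder : ∀ t ∈ Ioo 0 T, HasDerivAt h (h' t) t := by
    intro t ht
    have hnhds : Ico 0 T ∈ 𝓝 t := Ico_mem_nhds ht.1 ht.2
    refine hasDerivAt_slicedCost hn
      (fun i j => (hS.ode t (Ioo_subset_Ico_self ht) i j).hasDerivAt hnhds) ?_
      fun i j => (hS.continuousOn_gainError i j).continuousAt hnhds
    filter_upwards [hnhds] with s hs using quadForm_pos (hpd s hs)
  have hdle : ∀ t ∈ Ioo 0 T, h' t ≤ -(2 * c * N t / (T - t)) := by
    intro t ht
    have hTt := sub_pos.2 ht.2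
    have h1 := sum_mul_lyapunov_ge (transpose_gainError Cf (S t)) (hcS t (Ioo_subset_Ico_self ht))
    have h2 : h' t = -((T - t)⁻¹ * ∑ p : Fin n × Fin n, gainError Cf (S t) p.1 p.2 *
        (gainError Cf (S t) * S t + S t * (gainError Cf (S t))ᵀ) p.1 p.2) := by
      simp only [hh', feedbackGain_eq_smul_gainError, Matrix.transpose_smul, Matrix.smul_mul,
        Matrix.mul_smul, ← smul_add, Matrix.smul_apply, smul_eq_mul, Finset.mul_sum]
      congr 1
      exact Finset.sum_congr rfl fun p _ => by ring
    rw [h2, neg_le_neg_iff, div_eq_inv_mul]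
    gcongr
  have hN0 : ∀ t, 0 ≤ N t := fun t => Finset.sum_nonneg fun p _ => sq_nonneg _
  have hanti : AntitoneOn h (Ioo 0 T) := by
    refine antitoneOn_of_deriv_nonpos (convex_Ioo 0 T)
      (fun t ht => (hder t ht).continuousAt.continuousWithinAt) ?_ ?_ <;> rw [interior_Ioo]
    · exact fun t ht => (hder t ht).differentiableAt.differentiableWithinAt
    · intro t ht
      rw [(hder t ht).deriv]
      refine (hdle t ht).trans (neg_nonpos.2 ?_)
      have := sub_pos.2 ht.2
      have := hN0 t
      positivity
  -- Monotonicity of `h` is established on the open interval, so an interior time serves as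
  -- reference.
  obtain ⟨a, ha⟩ := exists_between hT
  -- the solution is bounded near the terminal time
  set R : ℝ := n * (2 * h a) + 2 * Cf.trace with hR
  have hbd : ∀ t ∈ Ioo a T, ∀ i j, |S t i j| ≤ R := by
    intro t ht i j
    have ht0 : t ∈ Ioo 0 T := ⟨ha.1.trans ht.1, ht.2⟩
    have hps := (hpd t (Ioo_subset_Ico_self ht0)).posSemidef
    refine (abs_apply_le_trace hps i j).trans ((trace_le_slicedCost hn hps hCf).trans ?_)
    have h1 : slicedCost Cf (S t) ≤ h a := hanti ha ht0 ht.1.le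
    rw [hR]
    gcongr
  -- `Q` bounds the squared Frobenius norm of `Cf - S t`; the summand `1` makes it positive, as `k =
  -- 2c/Q` requires.
  set Q : ℝ := ∑ p : Fin n × Fin n, (|Cf p.1 p.2| + R) ^ 2 + 1 with hQ
  have hQ0 : 0 < Q := by positivity
  -- Convexity against `Cf`, where the cost vanishes, followed by Cauchy–Schwarz.
  have hhN : ∀ t ∈ Ioo a T, h t ^ 2 ≤ N t * Q := by
    intro t ht
    have ht0 : t ∈ Ico 0 T := ⟨(ha.1.trans ht.1).le, ht.2⟩
    have h1 := slicedCost_sub_le (G := Cf) hn (quadForm_pos (hpd t ht0)) (quadForm_nonneg hCf)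
    rw [slicedCost_self, sub_zero] at h1
    calc h t ^ 2 ≤ (∑ p : Fin n × Fin n, gainError Cf (S t) p.1 p.2 * (Cf - S t) p.1 p.2) ^ 2 := by
          have := slicedCost_nonneg Cf (S t)
          gcongr
      _ ≤ N t * ∑ p : Fin n × Fin n, (Cf - S t) p.1 p.2 ^ 2 := Finset.sum_mul_sq_le_sq_mul_sq _ _ _
      _ ≤ N t * Q := by
          refine mul_le_mul_of_nonneg_left ?_ (hN0 t)
          refine (Finset.sum_le_sum fun p _ => ?_).trans (le_add_of_nonneg_right zero_le_one)
          rw [← sq_abs, Matrix.sub_apply]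
          have h2 := (abs_sub (Cf p.1 p.2) (S t p.1 p.2))
          have h3 := hbd t ht p.1 p.2
          gcongr
          linarith
  have hlim : Tendsto h (𝓝[<] T) (𝓝 0) := by
    refine tendsto_zero_of_deriv_le (k := 2 * c / Q) ha.2 (by positivity)
      (fun t ht => hder t ⟨ha.1.trans ht.1, ht.2⟩) (fun t => slicedCost_nonneg _ _) fun t ht => ?_
    refine (hdle t ⟨ha.1.trans ht.1, ht.2⟩).trans (neg_le_neg ?_)
    have hTt := sub_pos.2 ht.2
    have : 2 * c / Q * h t ^ 2 ≤ 2 * c * N t := by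
      calc 2 * c / Q * h t ^ 2 ≤ 2 * c / Q * (N t * Q) := by
            have := hhN t ht
            gcongr
        _ = _ := by field_simp
    gcongr
  -- the target covariance is the only cluster point
  set B : Set (Fin n → Fin n → ℝ) :=
    {A | ∀ i j, A i j ∈ Icc (-R) R} ∩ {A | (Matrix.of A).PosSemidef} with hB
  have hBc : IsCompact B := by
    have h1 : IsCompact {A : Fin n → Fin n → ℝ | ∀ i j, A i j ∈ Icc (-R) R} := by
      have := isCompact_univ_pi fun _ : Fin n => isCompact_univ_pi fun _ : Fin n =>
        isCompact_Icc (a := -R) (b := R)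
      convert this using 1
      ext A
      simp only [mem_ofPred_eq, mem_univ_pi]
    refine h1.inter_right ?_
    have h2 : {A : Fin n → Fin n → ℝ | (Matrix.of A).PosSemidef}
        = {A | (∀ i j, A j i = A i j) ∧ ∀ x : Fin n → ℝ, 0 ≤ x ⬝ᵥ (Matrix.of A *ᵥ x)} := by
      ext A
      simp only [mem_ofPred_eq, Matrix.posSemidef_iff_dotProduct_mulVec, star_trivial]
      refine and_congr ⟨fun h i j => h.apply i j, fun h => Matrix.IsHermitian.ext h⟩ Iff.rfl
    rw [h2, ofPred_and]
    refine IsClosed.inter ?_ ?_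
    · simp only [ofPred_forall]
      exact isClosed_iInter fun i => isClosed_iInter fun j =>
        isClosed_eq (by fun_prop) (by fun_prop)
    · simp only [ofPred_forall]
      refine isClosed_iInter fun x => isClosed_le continuous_const ?_
      simp only [dotProduct, mulVec, Matrix.of_apply]
      fun_prop
  refine hBc.tendsto_nhds_of_unique_mapClusterPt (f := S) ?_ fun A hA hcl => ?_
  · filter_upwards [Ioo_mem_nhdsLT ha.2] with t ht
    exact ⟨fun i j => abs_le.1 (hbd t ht i j),
      (hpd t ⟨(ha.1.trans ht.1).le, ht.2⟩).posSemidef⟩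
  · refine eq_of_slicedCost_eq_zero (A := A) hA.2 hCf ?_
    have h1 : MapClusterPt (slicedCost Cf A) (𝓝[<] T) h :=
      hcl.continuousAt_comp (f := slicedCost Cf) (continuous_slicedCost Cf).continuousAt
    exact eq_of_nhds_neBot (ClusterPt.mono h1 hlim)

end CovarianceSolution

/-! ### The feedback between Gaussians. -/

section Feedback

variable {T t : ℝ} {Cf A : Matrix (Fin n) (Fin n) ℝ}

/-- The optimal transport maps between the slices of `N(m, A)` and `N(mf, Cf)`. -/
def gaussianTransport (mf m : Vec n) (Cf A : Matrix (Fin n) (Fin n) ℝ) (θ : Sphere n) (s : ℝ) : ℝ :=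
  ⟪(θ : Vec n), mf⟫ + √(quadForm Cf θ / quadForm A θ) * (s - ⟪(θ : Vec n), m⟫)

lemma continuous_slicedIntegrand_gaussianTransport (hA : ∀ θ, 0 < quadForm A θ)
    (mf m z : Vec n) : Continuous (slicedIntegrand (gaussianTransport mf m Cf A) z) := by
  have hc := continuous_sqrt_div (G := Cf) hA
  unfold slicedIntegrand gaussianTransport
  fun_prop

/-- Between Gaussians the sliced feedback is affine. -/
lemma slicedFeedback_gaussianTransport (hn : 0 < n) (hA : ∀ θ, 0 < quadForm A θ)
    (mf m z : Vec n) :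
    slicedFeedback T t (gaussianTransport mf m Cf A) z
      = -(((T - t)⁻¹ * (1 / n)) • (m - mf))
        + toEuclideanCLM (𝕜 := ℝ) (feedbackGain T Cf t A) (z - m) := by
  have hc := continuous_sqrt_div (G := Cf) hA
  have hint := integrable_of_continuous
    (continuous_slicedIntegrand_gaussianTransport (Cf := Cf) hA mf m z)
  -- The integrand is `θθᵀ(z - mf) - r θθᵀ(z - m)` with `r` the slope of the slice map. Splitting `z
  -- - mf = (z - m) + (m - mf)` later separates the mean drift from the linear part.
  have key : ∀ i, (∫ θ, slicedIntegrand (gaussianTransport mf m Cf A) z θ ∂(sphereMeasure n)) i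
      = (1 / n) * (z - mf) i - ∑ j, slicedGain Cf A i j * (z - m) j := by
    intro i
    have h0 : (∫ θ, slicedIntegrand (gaussianTransport mf m Cf A) z θ ∂(sphereMeasure n)) i
        = ∫ θ, (slicedIntegrand (gaussianTransport mf m Cf A) z θ) i ∂(sphereMeasure n) :=
      ((EuclideanSpace.proj (𝕜 := ℝ) i).integral_comp_comm hint).symm
    have h1 : ∀ θ : Sphere n, (slicedIntegrand (gaussianTransport mf m Cf A) z θ) i
        = ∑ j, ((θ : Vec n) i * (θ : Vec n) j) * (z - mf) j
          - ∑ j, (√(quadForm Cf θ / quadForm A θ) * ((θ : Vec n) i * (θ : Vec n) j))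
            * (z - m) j := by
      intro θ
      have e1 : ∀ v : Vec n, ∑ j, ((θ : Vec n) i * (θ : Vec n) j) * v j
          = (θ : Vec n) i * ⟪(θ : Vec n), v⟫ := by
        intro v
        rw [inner_eq_dotProduct, dotProduct, Finset.mul_sum]
        exact Finset.sum_congr rfl fun j _ => by ring
      simp_rw [mul_assoc √(_)]
      rw [← Finset.mul_sum, e1, e1, inner_sub_right, inner_sub_right]
      simp only [slicedIntegrand, gaussianTransport, PiLp.smul_apply, smul_eq_mul]
      ring
    rw [h0]
    simp_rw [h1]
    rw [integral_sub (integrable_of_continuous (by fun_prop))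
        (integrable_of_continuous (by fun_prop)),
      integral_finsetSum _ fun j _ => integrable_of_continuous (by fun_prop),
      integral_finsetSum _ fun j _ => integrable_of_continuous (by fun_prop)]
    simp_rw [integral_mul_const, integral_mul_sphere hn]
    congr 1
    simp [Matrix.one_apply]
  have hK : ∀ i, toEuclideanCLM (𝕜 := ℝ) (feedbackGain T Cf t A) (z - m) i
      = (T - t)⁻¹ * (∑ j, slicedGain Cf A i j * (z - m) j - (1 / n) * (z - m) i) := by
    intro i
    rw [Matrix.ofLp_toEuclideanCLM, feedbackGain, Matrix.smul_mulVec, Matrix.sub_mulVec,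
      Matrix.smul_mulVec, Matrix.one_mulVec]
    rfl
  ext i
  simp only [slicedFeedback, PiLp.neg_apply, PiLp.smul_apply, PiLp.add_apply, key, hK, smul_eq_mul,
    PiLp.sub_apply]
  ring

end Feedback

/-! ### The fundamental matrix of the linear closed loop. -/

section MatrixCurves

/-- This transfers entrywise continuity and derivatives to curves of operators, where the linear
theory applies. -/
lemma toEuclideanCLM_eq_sum (A : Matrix (Fin n) (Fin n) ℝ) :
    toEuclideanCLM (𝕜 := ℝ) A = ∑ p : Fin n × Fin n,
      A p.1 p.2 • toEuclideanCLM (𝕜 := ℝ) (Matrix.single p.1 p.2 (1 : ℝ)) := by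
  conv_lhs => rw [Matrix.matrix_eq_sum_single A]
  simp_rw [Fintype.sum_prod_type, map_sum, ← map_smul, Matrix.smul_single, smul_eq_mul, mul_one]

lemma hasDerivWithinAt_toEuclideanCLM {S : ℝ → Matrix (Fin n) (Fin n) ℝ}
    {S' : Matrix (Fin n) (Fin n) ℝ} {s : Set ℝ} {t : ℝ}
    (h : ∀ i j, HasDerivWithinAt (fun t => S t i j) (S' i j) s t) :
    HasDerivWithinAt (fun t => toEuclideanCLM (𝕜 := ℝ) (S t)) (toEuclideanCLM (𝕜 := ℝ) S') s t := by
  simp_rw [toEuclideanCLM_eq_sum (S _), toEuclideanCLM_eq_sum S']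
  exact HasDerivWithinAt.fun_sum fun p _ => (h p.1 p.2).smul_const
    (toEuclideanCLM (𝕜 := ℝ) (Matrix.single p.1 p.2 (1 : ℝ)) : Vec n →L[ℝ] Vec n)

lemma continuousOn_toEuclideanCLM {S : ℝ → Matrix (Fin n) (Fin n) ℝ} {s : Set ℝ}
    (h : ∀ i j, ContinuousOn (fun t => S t i j) s) :
    ContinuousOn (fun t => toEuclideanCLM (𝕜 := ℝ) (S t)) s := by
  simp_rw [toEuclideanCLM_eq_sum (S _)]
  exact continuousOn_finsetSum _ fun p _ => (h p.1 p.2).smul continuousOn_const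

lemma star_toEuclideanCLM (A : Matrix (Fin n) (Fin n) ℝ) :
    star (toEuclideanCLM (𝕜 := ℝ) A) = toEuclideanCLM (𝕜 := ℝ) Aᵀ := by
  rw [← map_star, Matrix.star_eq_conjTranspose, Matrix.conjTranspose_eq_transpose_of_trivial]

variable {T : ℝ} {C₀ Cf : Matrix (Fin n) (Fin n) ℝ} {S : ℝ → Matrix (Fin n) (Fin n) ℝ}

/-- The covariance equation is solved by conjugation with the fundamental solution of the linear
closed loop. -/
lemma IsCovarianceSolution.exists_fundamental (hT : 0 < T) (hS : IsCovarianceSolution T C₀ Cf S) :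
    ∃ M : ℝ → Matrix (Fin n) (Fin n) ℝ, M 0 = 1 ∧ ∀ t ∈ Ico 0 T, M t * C₀ * (M t)ᵀ = S t ∧
      HasDerivWithinAt (fun t => toEuclideanCLM (𝕜 := ℝ) (M t))
        (toEuclideanCLM (𝕜 := ℝ) (feedbackGain T Cf t (S t)) * toEuclideanCLM (𝕜 := ℝ) (M t))
        (Ico 0 T) t := by
  set K : ℝ → (Vec n →L[ℝ] Vec n) :=
    fun t => toEuclideanCLM (𝕜 := ℝ) (feedbackGain T Cf t (S t)) with hKdef
  have hK : ContinuousOn K (Ico 0 T) := by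
    refine continuousOn_toEuclideanCLM fun i j => ?_
    simp only [feedbackGain_eq_smul_gainError, Matrix.smul_apply, smul_eq_mul]
    exact (ContinuousOn.inv₀ (by fun_prop) fun t ht => (sub_pos.2 ht.2).ne').mul
      (hS.continuousOn_gainError i j)
  obtain ⟨Φ, hΦ0, hΦ⟩ := exists_fundamental_solution hT hK
  have hM : ∀ t, toEuclideanCLM (𝕜 := ℝ) ((toEuclideanCLM (n := Fin n) (𝕜 := ℝ)).symm (Φ t))
      = Φ t := fun t => StarAlgEquiv.apply_symm_apply _ _
  refine ⟨fun t => (toEuclideanCLM (n := Fin n) (𝕜 := ℝ)).symm (Φ t), by simp [hΦ0],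
    fun t ht => ⟨?_, by simpa only [hM] using hΦ t ht⟩⟩
  have : ContinuousStar (Vec n →L[ℝ] Vec n) :=
    ⟨(ContinuousLinearMap.adjoint (𝕜 := ℝ) (E := Vec n) (F := Vec n)).continuous⟩
  -- With `K` computed along the given `S`, both `Φ C₀ Φ*` and `S` solve the same linear equation
  -- `X' = KX + XK*` from `C₀`.
  have heq := eqOn_of_linear_ode (K := K) (L := fun t => star (K t))
    (X := fun t => Φ t * toEuclideanCLM (𝕜 := ℝ) C₀ * star (Φ t))
    (Y := fun t => toEuclideanCLM (𝕜 := ℝ) (S t)) hK hK.star ?_ ?_ ?_ ht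
  · apply EquivLike.injective (toEuclideanCLM (n := Fin n) (𝕜 := ℝ))
    rw [map_mul, map_mul, ← star_toEuclideanCLM, hM]
    exact heq
  · intro t ht
    refine (((hΦ t ht).mul_const _).mul (hΦ t ht).star).congr_deriv ?_
    rw [star_mul]
    noncomm_ring
  · intro t ht
    refine (hasDerivWithinAt_toEuclideanCLM (hS.ode t ht)).congr_deriv ?_
    simp only [map_add, map_mul, hKdef, star_toEuclideanCLM]
  · simp [hΦ0, hS.initial]

end MatrixCurves

/-! ### The mean of the closed loop. -/

section Mean

/-- The mean of the closed loop. -/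
def closedLoopMean (T : ℝ) (m₀ mf : Vec n) (t : ℝ) : Vec n :=
  mf + (((T - t) / T) ^ (1 / (n : ℝ))) • (m₀ - mf)

variable {T : ℝ} (m₀ mf : Vec n)

lemma closedLoopMean_zero (hT : 0 < T) : closedLoopMean T m₀ mf 0 = m₀ := by
  simp [closedLoopMean, hT.ne']

/-- This is the mean part of the affine feedback; the exponent `1/n` reflects `∫ θθᵀ dσ = I/n`. -/
lemma hasDerivAt_closedLoopMean (hT : 0 < T) {t : ℝ} (ht : t < T) :
    HasDerivAt (closedLoopMean T m₀ mf)
      (-(((T - t)⁻¹ * (1 / n)) • (closedLoopMean T m₀ mf t - mf))) t := by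
  have hTt := sub_pos.2 ht
  have hpos : 0 < (T - t) / T := div_pos hTt hT
  have h := (((((hasDerivAt_id t).const_sub T).div_const T).rpow_const
    (p := 1 / (n : ℝ)) (Or.inl hpos.ne')).smul_const (m₀ - mf)).const_add mf
  refine h.congr_deriv ?_
  simp only [closedLoopMean, add_sub_cancel_left, smul_smul, ← neg_smul, id]
  congr 1
  rw [Real.rpow_sub_one hpos.ne']
  field_simp

lemma tendsto_closedLoopMean (hn : 0 < n) :
    Tendsto (closedLoopMean T m₀ mf) (𝓝[<] T) (𝓝 mf) := by
  have hn' : (0 : ℝ) < 1 / n := by positivity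
  have h : ContinuousAt (closedLoopMean T m₀ mf) T := by
    refine continuousAt_const.add (ContinuousAt.smul (ContinuousAt.rpow_const ?_ (Or.inr hn'.le))
      continuousAt_const)
    exact (continuousAt_const.sub continuousAt_id).div_const T
  have h2 : closedLoopMean T m₀ mf T = mf := by
    simp [closedLoopMean, Real.zero_rpow (inv_pos.2 (Nat.cast_pos.2 hn)).ne']
  have h3 := h.tendsto
  rw [h2] at h3
  exact h3.mono_left nhdsWithin_le_nhds

end Mean

/-! ### Construction of the Gaussian closed loop. -/

/-- An invertible affine map is nonsingular for the Lebesgue measure. -/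
lemma quasiMeasurePreserving_affine (m m' : Vec n) {M : Matrix (Fin n) (Fin n) ℝ}
    (hM : IsUnit M) : Measure.QuasiMeasurePreserving
      (fun x : Vec n => m' + toEuclideanCLM (𝕜 := ℝ) M (x - m)) volume volume := by
  have h1 : IsUnit (toEuclideanCLM (𝕜 := ℝ) M) := hM.map _
  have h2 : IsUnit ((toEuclideanCLM (𝕜 := ℝ) M : Vec n →L[ℝ] Vec n) : Vec n →ₗ[ℝ] Vec n) :=
    h1.map (ContinuousLinearMap.toLinearMapRingHom (R₁ := ℝ) (M₁ := Vec n))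
  have h3 : Measure.QuasiMeasurePreserving (toEuclideanCLM (𝕜 := ℝ) M)
      (volume : Measure (Vec n)) volume := by
    refine ⟨by fun_prop, ?_⟩
    have h4 := Measure.map_linearMap_addHaar_eq_smul_addHaar (volume : Measure (Vec n))
      (h2.map LinearMap.det).ne_zero
    rw [ContinuousLinearMap.coe_coe] at h4
    rw [h4]
    exact Measure.smul_absolutelyContinuous
  exact ((measurePreserving_add_left volume m').quasiMeasurePreserving.comp h3).comp
    (measurePreserving_sub_right volume m).quasiMeasurePreserving

section ClosedLoop

/-- A random vector with law `N(a, C)` has mean `a`. -/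
lemma integral_of_map_eq_multivariateGaussian {Ω : Type*} [MeasurableSpace Ω] {P : Measure Ω}
    {X : Ω → Vec n} (hX : AEMeasurable X P)
    {a : Vec n} {C : Matrix (Fin n) (Fin n) ℝ} (h : P.map X = multivariateGaussian a C) :
    ∫ ω, X ω ∂P = a := by
  have h1 := integral_map (f := fun x : Vec n => x) hX (by fun_prop)
  rw [← h1, h, integral_id_multivariateGaussian]

/-- A random vector with law `N(a, C)` has covariance `C`. -/
lemma covMatrix_of_map_eq_multivariateGaussian {Ω : Type*} [MeasurableSpace Ω] {P : Measure Ω}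
    {X : Ω → Vec n} (hX : AEMeasurable X P)
    {a : Vec n} {C : Matrix (Fin n) (Fin n) ℝ} (hC : C.PosSemidef)
    (h : P.map X = multivariateGaussian a C) : covMatrix P X = C := by
  ext i j
  rw [covMatrix, Matrix.of_apply, ← covariance_eval_multivariateGaussian (μ := a) hC, ← h,
    covariance_map (by fun_prop) (by fun_prop) hX]
  rfl

variable {Ω : Type*} [MeasurableSpace Ω] {P : Measure Ω} [IsProbabilityMeasure P] {T : ℝ}
  {m₀ : Vec n} (mf : Vec n) {C₀ Cf : Matrix (Fin n) (Fin n) ℝ}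
  {S : ℝ → Matrix (Fin n) (Fin n) ℝ}

/-- Every random vector with a Gaussian law is the initial state of a Gaussian solution of the
closed loop. -/
lemma IsCovarianceSolution.exists_gaussian_closedLoop (hn : 0 < n) (hT : 0 < T)
    (hC₀ : C₀.PosSemidef) (hCf : Cf.PosDef) (hS : IsCovarianceSolution T C₀ Cf S) {x₀ : Ω → Vec n}
    (hx₀ : MemLp x₀ 2 P) (hac : P.map x₀ ≪ volume)
    (hlaw : P.map x₀ = multivariateGaussian m₀ C₀) :
    ∃ y : ℝ → Ω → Vec n, y 0 = x₀ ∧ IsClosedLoop P T (multivariateGaussian mf Cf) y ∧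
      ∀ t ∈ Ico 0 T, P.map (y t) = multivariateGaussian (closedLoopMean T m₀ mf t) (S t) := by
  obtain ⟨c, hc, hcS⟩ := hS.posDef
  have hpd : ∀ t ∈ Ico 0 T, (S t).PosDef := fun t ht => posDef_of_sub_smul_one hc (hcS t ht)
  obtain ⟨M, hM0, hM⟩ := hS.exists_fundamental hT
  set m := closedLoopMean T m₀ mf with hm
  set y : ℝ → Ω → Vec n := fun t ω => m t + toEuclideanCLM (𝕜 := ℝ) (M t) (x₀ ω - m₀) with hy
  have hmap : ∀ t, P.map (y t)
      = (P.map x₀).map (fun x => m t + toEuclideanCLM (𝕜 := ℝ) (M t) (x - m₀)) := by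
    intro t
    rw [AEMeasurable.map_map_of_aemeasurable (by fun_prop) hx₀.1.aemeasurable]
    rfl
  have hylaw : ∀ t ∈ Ico 0 T, P.map (y t) = multivariateGaussian (m t) (S t) := by
    intro t ht
    rw [hmap, hlaw, multivariateGaussian_map_affine m₀ (m t) hC₀, (hM t ht).1]
  refine ⟨y, ?_, ⟨fun t => gaussianTransport mf (m t) Cf (S t), fun t ht => ⟨?_, ?_, fun θ => ?_⟩,
    ae_of_all _ fun ω t ht => ⟨?_, ?_⟩⟩, hylaw⟩
  · ext1 ω
    simp [hy, hM0, hm, closedLoopMean_zero m₀ mf hT]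
  · exact (memLp_const (m t)).add
      ((toEuclideanCLM (𝕜 := ℝ) (M t)).comp_memLp' (hx₀.sub (memLp_const m₀)))
  -- `S t = M t C₀ (M t)ᵀ` has nonzero determinant, so `M t` is invertible and the state keeps a
  -- density.
  · have hu : IsUnit (M t) := by
      have h1 := (hpd t ht).det_pos.ne'
      rw [← (hM t ht).1, Matrix.det_mul, Matrix.det_mul] at h1
      exact (Matrix.isUnit_iff_isUnit_det _).2
        (isUnit_iff_ne_zero.2 (left_ne_zero_of_mul (left_ne_zero_of_mul h1)))
    rw [hmap]
    have hq := quasiMeasurePreserving_affine m₀ (m t) hu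
    exact (hac.map hq.measurable).trans hq.absolutelyContinuous
  · rw [hylaw t ht]
    exact isOptimalTransportMap_slice (hpd t ht).posSemidef hCf.posSemidef θ
      (quadForm_pos (hpd t ht) θ) (quadForm_pos hCf θ)
  · exact integrable_of_continuous
      (continuous_slicedIntegrand_gaussianTransport (quadForm_pos (hpd t ht)) _ _ _)
  · rw [slicedFeedback_gaussianTransport hn (quadForm_pos (hpd t ht))]
    refine ((hasDerivAt_closedLoopMean m₀ mf hT ht.2).hasDerivWithinAt.add
      ((hM t ht).2.clm_apply (hasDerivWithinAt_const _ _ (x₀ ω - m₀)))).congr_deriv ?_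
    simp [hy, hm]

end ClosedLoop

end SlicedSteering

end

open SlicedSteering
theorem mainTheorem1 (n : ℕ) (hn : 0 < n) :
    -- convergence of the mean and of the covariance of the state
    (∀ {Ω : Type*} [MeasurableSpace Ω] (P : Measure Ω) [IsProbabilityMeasure P]
      (T : ℝ) (_ : 0 < T)
      (m₀ mf : Vec n) (C₀ Cf : Matrix (Fin n) (Fin n) ℝ) (_ : C₀.PosDef) (_ : Cf.PosDef)
      (x : ℝ → Ω → Vec n)
      -- `x` is the unique solution of the closed loop with Gaussian initial law
      (_ : P.map (x 0) = multivariateGaussian m₀ C₀)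
      (_ : IsClosedLoop P T (multivariateGaussian mf Cf) x)
      (_ : ∀ y : ℝ → Ω → Vec n, y 0 =ᵐ[P] x 0 →
        IsClosedLoop P T (multivariateGaussian mf Cf) y → ∀ t ∈ Ico 0 T, y t =ᵐ[P] x t)
      -- the covariance equation is solvable in the positive definite matrices
      (S : ℝ → Matrix (Fin n) (Fin n) ℝ) (_ : IsCovarianceSolution T C₀ Cf S),
      (∀ t ∈ Ico 0 T, P.map (x t) = multivariateGaussian (∫ ω, x t ω ∂P) (S t)) ∧
      Tendsto (fun t => ∫ ω, x t ω ∂P) (𝓝[<] T) (𝓝 mf) ∧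
      Tendsto (fun t => covMatrix P (x t)) (𝓝[<] T) (𝓝 Cf)) ∧
    -- the rigidity of the stationarity condition
    (∀ A G : Matrix (Fin n) (Fin n) ℝ, A.PosDef → G.PosSemidef →
      slicedGain G A = (1 / (n : ℝ)) • (1 : Matrix (Fin n) (Fin n) ℝ) → A = G) := by
  refine ⟨?_, fun A G hA hG h => eq_of_gainError_eq_zero hn hA hG (sub_eq_zero.2 h)⟩
  intro Ω _ P _ T hT m₀ mf C₀ Cf hC₀ hCf x hx0 hx huniq S hS
  obtain ⟨c, hc, hcS⟩ := hS.posDef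
  have hx' : ∀ t ∈ Ico 0 T, MemLp (x t) 2 P ∧ P.map (x t) ≪ volume := by
    obtain ⟨τ, hτ, -⟩ := hx
    exact fun t ht => ⟨(hτ t ht).1, (hτ t ht).2.1⟩
  have h0 : (0 : ℝ) ∈ Ico 0 T := ⟨le_rfl, hT⟩
  -- The Gaussian solution starts from the random vector `x 0` itself, so uniqueness identifies it
  -- with `x` at every time.
  obtain ⟨y, hy0, hy, hylaw⟩ := hS.exists_gaussian_closedLoop mf hn hT hC₀.posSemidef hCf
    (hx' 0 h0).1 (hx' 0 h0).2 hx0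
  have hlaw : ∀ t ∈ Ico 0 T,
      P.map (x t) = multivariateGaussian (closedLoopMean T m₀ mf t) (S t) := by
    intro t ht
    rw [← hylaw t ht]
    exact Measure.map_congr (huniq y (by rw [hy0]) hy t ht).symm
  have hmeas : ∀ t ∈ Ico 0 T, AEMeasurable (x t) P := fun t ht => (hx' t ht).1.1.aemeasurable
  have hmean : ∀ t ∈ Ico 0 T, ∫ ω, x t ω ∂P = closedLoopMean T m₀ mf t := fun t ht =>
    integral_of_map_eq_multivariateGaussian (hmeas t ht) (hlaw t ht)
  have hev : ∀ᶠ t in 𝓝[<] T, t ∈ Ico 0 T := by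
    filter_upwards [Ioo_mem_nhdsLT hT] with t ht using Ioo_subset_Ico_self ht
  refine ⟨fun t ht => by rw [hmean t ht, hlaw t ht], ?_, ?_⟩
  · refine (tendsto_closedLoopMean m₀ mf hn).congr' ?_
    filter_upwards [hev] with t ht using (hmean t ht).symm
  · refine (hS.tendsto hn hT hCf.posSemidef).congr' ?_
    filter_upwards [hev] with t ht
    exact (covMatrix_of_map_eq_multivariateGaussian (hmeas t ht)
      (posDef_of_sub_smul_one hc (hcS t ht)).posSemidef (hlaw t ht)).symm
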